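/- Let $\alpha\in(0,1)$, $k\in\{1,\dots,6\}$, $T>0$ and $\beta_0>0$. There are constants $C,c>0$, depending only on $\alpha,k,T,\beta_0$, with the following property. Let $V\subset H\subset V'$ be a Gelfand triple of complex Hilbert spaces ($V$ continuously and densely embedded in $H$, $V'$ the space of bounded conjugate-linear functionals on $V$), let $\|\cdot\|$ be the norm of $H$, and let $A:V\to V'$ be bounded, linear and self-adjoint with $\beta_0\|u\|_V^2\le\langle Au,u\rangle\le\beta_1\|u\|_V^2$ for all $u\in V$ and some $\beta_1$. Let $v\in H$, let $f\in C^{\max(k-2,0)}([0,T];V')$, let $N\ge 2$, $\tau=T/N$ and $t_n=n\tau$. Let $\omega_j$ be the coefficients of the power series $$\Big(\sum_{\ell=1}^k \tfrac1\ell(1-\xi)^\ell\Big)^\alpha=\sum_{j=0}^\infty\omega_j\xi^j ,$$ put $\bar\partial_\tau^\alpha U^n=\tau^{-\alpha}\sum_{j=0}^\infty\omega_jU^{n-j}$ and $$\bar f_n=f(t_n)+a_n\,(f(0)-Av)+\sum_{\ell=1}^{k-2}b_{\ell,n}\,\tau^\ell\,\partial_t^\ell f(0),$$ where $a_n=a_n^{(k)}$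 and $b_{\ell,n}=b_{\ell,n}^{(k)}$ are the standard starting corrections of the corrected BDF$k$ convolution quadrature: they are zero except for - $k=2$: $a_1=\frac12$; - $k=3$: $(a_1,a_2)=(\frac{11}{12},-\frac5{12})$, $b_{1,1}=\frac1{12}$; - $k=4$: $(a_1,a_2,a_3)=(\frac{31}{24},-\frac76,\frac38)$, $(b_{1,1},b_{1,2})=(\frac16,-\frac1{12})$; - $k=5$: $(a_1,\dots,a_4)=(\frac{1181}{720},-\frac{177}{80},\frac{341}{240},-\frac{251}{720})$, $(b_{1,1},b_{1,2},b_{1,3})=(\frac{59}{240},-\frac{29}{120},\frac{19}{240})$, $(b_{2,1},b_{2,2})=(\frac1{240},-\frac1{240})$, $b_{3,1}=\frac1{720}$; - $k=6$: $(a_1,\dots,a_5)=(\frac{2837}{1440},-\frac{2543}{720},\frac{17}5,-\frac{1201}{720},\frac{95}{288})$, $(b_{1,1},\dots,b_{1,4})=(\frac{77}{240},-\frac7{15},\frac{73}{240},-\frac3{40})$, $(b_{2,1},b_{2,2},b_{2,3})=(\frac1{96},-\frac1{60},\frac1{160})$, $(b_{3,1},b_{3,2})=(-\frac1{360},\frac1{720})$.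 Let $(U^n)$ solve the CQ-BDF$k$ subdiffusion scheme $$\bar\partial_\tau^\alpha U^n+AU^n=\bar f_n\quad(1\le n\le N),\qquad U^n=v\quad(n\le 0),$$ and, for arbitrary starting values $U_0^n\in H$ ($1\le n\le N$) and a relaxation parameter $\kappa$, let $(U_m^n)$, $m\ge1$, solve the iterative scheme $$\begin{aligned}\bar\partial_\tau^\alpha U_m^n+AU_m^n&=\bar f_n, && 1\le n\le N,\\ U_m^{-n}&=v+\kappa\,(U_m^{N-n}-U_{m-1}^{N-n}), && 0\le n\le N-1,\\ U_m^n&=v, && n\le -N.\end{aligned}$$ (The equations hold in $V'$, with $U^n+a_nv\in V$ and $U_m^n+a_nv\in V$ for $1\le n\le N$; if $v\notin V$, the terms $AU^n+a_nAv$ are read as $A(U^n+a_nv)$.) Then for every $\kappa=O(1/\log N)$ in the range $0<\kappa<\frac1{2c\log N}$, the number $$\gamma(\kappa)=\frac{c\,\kappa\log N}{1-c\,\kappa\log N}$$ lies in $(0,1)$, and for all $m\ge1$ and $1\le n\le N$ $$\|U^n-U_m^n\|\le C\,t_n^{\alpha-1}\,\gamma(\kappa)^m\Big(\tau\sum_{j=1}^N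 t_j^{-\alpha}\,\|U^{N-j+1}-U_0^{N-j+1}\|\Big).$$ -/

import Mathlib

open scoped ComplexConjugate ContDiff

namespace CQBDF

/-- The space `V'` of bounded conjugate-linear functionals on `V`. -/
abbrev Antidual (V : Type*) [NormedAddCommGroup V] [InnerProductSpace ℂ V] : Type _ :=
  V →L⋆[ℂ] ℂ

/-- The generating function `δ_k(ζ) = ∑_{ℓ=1}^k (1-ζ)^ℓ / ℓ` of the `k`-step BDF method. -/
noncomputable def bdfGen (k : ℕ) (ζ : ℂ) : ℂ :=
  ∑ l ∈ Finset.Icc 1 k, (1 / (l : ℂ)) * (1 - ζ) ^ l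

/-- The convolution quadrature weight `ω_j^{(α)}`: the `j`-th Taylor coefficient at `0` of
`δ_k(ξ)^α` (principal branch; `δ_k(0) > 0`). -/
noncomputable def cqWeight (α : ℝ) (k j : ℕ) : ℂ :=
  iteratedDeriv j (fun ξ : ℂ => bdfGen k ξ ^ (α : ℂ)) 0 / (j.factorial : ℂ)

/-- The starting correction coefficients `a_n^{(k)}`; they vanish for `n ≥ k`. -/
def corrA : ℕ → ℕ → ℚ
  | 2, 1 => 1 / 2
  | 3, 1 => 11 / 12
  | 3, 2 => -5 / 12
  | 4, 1 => 31 / 24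
  | 4, 2 => -7 / 6
  | 4, 3 => 3 / 8
  | 5, 1 => 1181 / 720
  | 5, 2 => -177 / 80
  | 5, 3 => 341 / 240
  | 5, 4 => -251 / 720
  | 6, 1 => 2837 / 1440
  | 6, 2 => -2543 / 720
  | 6, 3 => 17 / 5
  | 6, 4 => -1201 / 720
  | 6, 5 => 95 / 288
  | _, _ => 0

/-- The starting correction coefficients `b_{ℓ,n}^{(k)}`, with arguments in the order
`k`, `ℓ`, `n`; they vanish for `n ≥ k`. -/
def corrB : ℕ → ℕ → ℕ → ℚ
  | 3, 1, 1 => 1 / 12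
  | 4, 1, 1 => 1 / 6
  | 4, 1, 2 => -1 / 12
  | 5, 1, 1 => 59 / 240
  | 5, 1, 2 => -29 / 120
  | 5, 1, 3 => 19 / 240
  | 5, 2, 1 => 1 / 240
  | 5, 2, 2 => -1 / 240
  | 5, 3, 1 => 1 / 720
  | 6, 1, 1 => 77 / 240
  | 6, 1, 2 => -7 / 15
  | 6, 1, 3 => 73 / 240
  | 6, 1, 4 => -3 / 40
  | 6, 2, 1 => 1 / 96
  | 6, 2, 2 => -1 / 60
  | 6, 2, 3 => 1 / 160
  | 6, 3, 1 => -1 / 360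
  | 6, 3, 2 => 1 / 720
  | _, _, _ => 0

section

variable {H V : Type*} [NormedAddCommGroup H] [InnerProductSpace ℂ H]
  [NormedAddCommGroup V] [InnerProductSpace ℂ V]

/-- `V ⊂ H ⊂ V'` is a Gelfand triple: `ι` embeds `V` continuously and densely into `H`. -/
structure IsGelfandEmbedding (ι : V →L[ℂ] H) : Prop where
  injective : Function.Injective ι
  denseRange : DenseRange ι

/-- The embedding `H ↪ V'`, `h ↦ (φ ↦ (h, φ))`. Mathlib's inner product is conjugate-linear in
its first argument, hence the order of the two entries. -/
noncomputable def toAntidual (ι : V →L[ℂ] H) (h : H) : Antidual V :=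
  (innerSLFlip ℂ h).comp ι

/-- `A : V → V'` is self-adjoint and elliptic with constants `β₀`, `β₁`. -/
structure IsSelfAdjointElliptic (A : V →L[ℂ] Antidual V) (β₀ β₁ : ℝ) : Prop where
  selfAdjoint : ∀ u w : V, A u w = conj (A w u)
  lower : ∀ u : V, β₀ * ‖u‖ ^ 2 ≤ (A u u).re
  upper : ∀ u : V, (A u u).re ≤ β₁ * ‖u‖ ^ 2

/-- The convolution quadrature derivative
`τ^{-α} ∑_{j=0}^∞ ω_j^{(α)} U^{n-j}` of a two-sided sequence `U`. -/
noncomputable def cqDeriv (α : ℝ) (k : ℕ) (τ : ℝ) (U : ℤ → H) (n : ℤ) : H :=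
  ((1 / τ ^ α : ℝ) : ℂ) • ∑' j : ℕ, cqWeight α k j • U (n - j)

/-- The part of the corrected source term which depends on `f` only:
`f(t_n) + a_n f(0) + ∑_{ℓ=1}^{k-2} b_{ℓ,n} τ^ℓ ∂_t^ℓ f(0)`, where `f` lives on `[0,T]`. -/
noncomputable def corrSource (k : ℕ) (T τ : ℝ) (f : ℝ → Antidual V) (n : ℕ) : Antidual V :=
  f (n * τ) + (corrA k n : ℂ) • f 0
    + ∑ l ∈ Finset.Icc 1 (k - 2),
        ((corrB k l n : ℂ) * (τ : ℂ) ^ l) • iteratedDerivWithin l f (Set.Icc 0 T) 0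

/-- The time stepping equation at step `n`, as an equation in `V'`:
`∂̄_τ^α U^n + A U^n = f(t_n) + a_n (f(0) - A v) + ∑_{ℓ=1}^{k-2} b_{ℓ,n} τ^ℓ ∂_t^ℓ f(0)`.
For `v ∈ H` the term `A v` need not lie in `V'`; therefore the two terms with `A` are collected
into `A (U^n + a_n v)`, which lies in `V'` exactly when `w = U^n + a_n v` lies in `V`.
For `v ∈ V` (and whenever `a_n = 0`) this is literally the displayed equation with `U^n ∈ V`. -/
def StepEq (ι : V →L[ℂ] H) (A : V →L[ℂ] Antidual V) (α : ℝ) (k : ℕ) (T τ : ℝ) (v : H)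
    (f : ℝ → Antidual V) (U : ℤ → H) (n : ℕ) : Prop :=
  ∃ w : V, ι w = U n + (corrA k n : ℂ) • v ∧
    toAntidual ι (cqDeriv α k τ U n) + A w = corrSource k T τ f n

/-- `U` solves the CQ-BDF`k` scheme with `N` steps of size `T / N`; the values `U n` with
`n > N` play no role. -/
structure IsCQSolution (ι : V →L[ℂ] H) (A : V →L[ℂ] Antidual V) (α : ℝ) (k : ℕ) (T : ℝ) (N : ℕ)
    (v : H) (f : ℝ → Antidual V) (U : ℤ → H) : Prop where
  history : ∀ n : ℤ, n ≤ 0 → U n = v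
  step : ∀ n : ℕ, 1 ≤ n → n ≤ N → StepEq ι A α k T (T / N) v f U n

/-- `U` is obtained from the previous iterate `Uprev` by one sweep of the iterative scheme with
relaxation parameter `κ`. -/
structure IsIterate (ι : V →L[ℂ] H) (A : V →L[ℂ] Antidual V) (α : ℝ) (k : ℕ) (T : ℝ) (N : ℕ)
    (v : H) (f : ℝ → Antidual V) (κ : ℝ) (Uprev U : ℤ → H) : Prop where
  step : ∀ n : ℕ, 1 ≤ n → n ≤ N → StepEq ι A α k T (T / N) v f U n
  history : ∀ n : ℕ, n < N →
    U (-(n : ℤ)) = v + (κ : ℂ) • (U ((N : ℤ) - n) - Uprev ((N : ℤ) - n))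
  farHistory : ∀ n : ℤ, n ≤ -(N : ℤ) → U n = v

end

/-- The convergence factor `γ(κ) = c κ log N / (1 - c κ log N)`. -/
noncomputable def convFactor (c κ : ℝ) (N : ℕ) : ℝ :=
  c * κ * Real.log N / (1 - c * κ * Real.log N)

end CQBDF

namespace CQBDF

/-- A common multiplier for the BDF methods of order at most `6`: both `bdfMultiplier` and
`bdfGen k / bdfMultiplier` have positive real part on the open unit disc. -/
noncomputable def bdfMultiplier (ζ : ℂ) : ℂ := (9 - 4 * ζ) * (2 - ζ) ^ 2

lemma bdfMultiplier_re_pos {ζ : ℂ} (h : ‖ζ‖ ≤ 1) : 0 < (bdfMultiplier ζ).re := by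
  have h1 : ζ.re ^ 2 + ζ.im ^ 2 ≤ 1 := by
    have := Complex.sq_norm ζ
    rw [Complex.normSq_apply] at this
    nlinarith [norm_nonneg ζ]
  have e : (bdfMultiplier ζ).re = 36 - 52 * ζ.re + 25 * (ζ.re ^ 2 - ζ.im ^ 2)
      - 4 * (ζ.re ^ 3 - 3 * ζ.re * ζ.im ^ 2) := by
    simp [bdfMultiplier, pow_succ]
    ring
  rw [e]
  set x := ζ.re
  set y := ζ.im
  have hx : -1 ≤ x ∧ x ≤ 1 := ⟨by nlinarith [sq_nonneg y], by nlinarith [sq_nonneg y]⟩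
  have h2 : 0 ≤ (25 - 12 * x) * (1 - x ^ 2 - y ^ 2) :=
    mul_nonneg (by linarith) (by linarith)
  have h3 : 0 < 11 - 40 * x + 50 * x ^ 2 - 16 * x ^ 3 := by
    nlinarith [mul_nonneg (sub_nonneg.2 hx.2) (sq_nonneg (x - 11 / 20)), sq_nonneg (x - 11 / 20)]
  nlinarith

lemma bdfMultiplier_ne_zero {ζ : ℂ} (h : ‖ζ‖ ≤ 1) : bdfMultiplier ζ ≠ 0 := fun h0 => by
  have := bdfMultiplier_re_pos h
  simp [h0] at this

lemma norm_bdfMultiplier_le {ζ : ℂ} (h : ‖ζ‖ ≤ 1) : ‖bdfMultiplier ζ‖ ≤ 117 := by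
  have h1 : ‖9 - 4 * ζ‖ ≤ 13 := (norm_sub_le _ _).trans (by simp; linarith)
  have h2 : ‖2 - ζ‖ ≤ 3 := (norm_sub_le _ _).trans (by simp; linarith)
  rw [bdfMultiplier, norm_mul, norm_pow]
  calc _ ≤ 13 * (3 : ℝ) ^ 2 := by gcongr
    _ = 117 := by norm_num

lemma bdf_quartic_pos {x : ℝ} (h₁ : x ≤ 1) :
    3 ≤ 1102 / 15 - 786 / 5 * x + 4868 / 15 * x ^ 2 - 328 * x ^ 3 + 576 / 5 * x ^ 4 := by
  nlinarith [mul_nonneg (sub_nonneg.2 h₁) (sq_nonneg (x - 1 / 2)), sq_nonneg (x - 1 / 2),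
    sq_nonneg (x ^ 2 - x), sq_nonneg (x ^ 2 - 1)]

lemma bdf_quintic_pos {x : ℝ} (h₁ : x ≤ 1) :
    3 ≤ 142 / 15 + 1222 / 15 * x + 2668 / 15 * x ^ 2 - 2060 / 3 * x ^ 3 + 9568 / 15 * x ^ 4
      - 192 * x ^ 5 := by
  rcases le_total x 0 with h | h
  · have h1 : 0 ≤ -x * (x + 3 / 25) ^ 2 := mul_nonneg (by linarith) (sq_nonneg _)
    have h2 : 0 ≤ -x * (x ^ 2) ^ 2 := mul_nonneg (by linarith) (sq_nonneg _)
    nlinarith [sq_nonneg (x + 2 / 15), sq_nonneg (x ^ 2)]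
  · have h1 : 0 ≤ (1 - x) * (x ^ 2) ^ 2 := mul_nonneg (by linarith) (sq_nonneg _)
    have h2 : 0 ≤ (1 - x) * x := mul_nonneg (by linarith) h
    nlinarith [sq_nonneg (x * (x - 77 / 100)), sq_nonneg x]

lemma bdfGen_mul_conj_re {k : ℕ} (hk₁ : 1 ≤ k) (hk₆ : k ≤ 6) {ζ : ℂ} (h : ‖ζ‖ = 1) :
    3 * (1 - ζ.re) ≤ (bdfGen k ζ * conj (bdfMultiplier ζ)).re := by
  have h0 : ζ ≠ 0 := fun h0 => by simp [h0] at h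
  have hc : conj ζ = ζ⁻¹ := by
    rw [Complex.inv_def, Complex.normSq_eq_norm_sq, h]; simp
  have hx : ((ζ.re : ℝ) : ℂ) = (ζ + ζ⁻¹) / 2 := by
    rw [Complex.re_eq_add_conj, hc]
  have hb : |ζ.re| ≤ 1 := h ▸ Complex.abs_re_le_norm ζ
  obtain ⟨hb₀, hb₁⟩ := abs_le.1 hb
  have key : ∀ p : ℝ, bdfGen k ζ * ((9 - 4 * ζ⁻¹) * (2 - ζ⁻¹) ^ 2) +
      bdfGen k ζ⁻¹ * ((9 - 4 * ζ) * (2 - ζ) ^ 2) = 2 * (1 - (ζ.re : ℂ)) * (p : ℂ) →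
      3 ≤ p → 3 * (1 - ζ.re) ≤ (bdfGen k ζ * conj (bdfMultiplier ζ)).re := by
    intro p hp hp3
    have h1 : (((bdfGen k ζ * conj (bdfMultiplier ζ)).re : ℝ) : ℂ)
        = (((1 - ζ.re) * p : ℝ) : ℂ) := by
      rw [Complex.re_eq_add_conj]
      have hg : conj (bdfGen k ζ) = bdfGen k ζ⁻¹ := by simp [bdfGen, hc]
      rw [map_mul, Complex.conj_conj, hg]
      simp only [bdfMultiplier, map_mul, map_sub, map_pow, map_ofNat, hc]
      rw [hp]; push_cast; ring
    rw [Complex.ofReal_inj.1 h1]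
    nlinarith
  interval_cases k
  · refine key (59 - 42 * ζ.re + 16 * ζ.re ^ 2) ?_ (by nlinarith [sq_nonneg (ζ.re - 1)])
    push_cast; rw [hx]
    simp [bdfGen]
    field_simp; ring
  · refine key (107 - 103 * ζ.re + 24 * ζ.re ^ 2) ?_ (by nlinarith [sq_nonneg (ζ.re - 1)])
    push_cast; rw [hx]
    simp [bdfGen, Finset.sum_Icc_succ_top]
    field_simp; ring
  · refine key (395 / 3 - 181 * ζ.re + 232 / 3 * ζ.re ^ 2) ?_
      (by nlinarith [sq_nonneg (ζ.re - 1)])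
    push_cast; rw [hx]
    simp [bdfGen, Finset.sum_Icc_succ_top]
    field_simp; ring
  · refine key (362 / 3 - 226 * ζ.re + 616 / 3 * ζ.re ^ 2 - 72 * ζ.re ^ 3) ?_
      (by nlinarith [sq_nonneg (ζ.re - 1), mul_nonneg (sub_nonneg.2 hb₁) (sq_nonneg (ζ.re - 1)),
        mul_nonneg (sub_nonneg.2 hb₁) (sq_nonneg ζ.re)])
    push_cast; rw [hx]
    simp [bdfGen, Finset.sum_Icc_succ_top]
    field_simp; ring
  · refine key _ ?_ (bdf_quartic_pos hb₁)
    push_cast; rw [hx]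
    simp [bdfGen, Finset.sum_Icc_succ_top]
    field_simp; ring
  · refine key _ ?_ (bdf_quintic_pos hb₁)
    push_cast; rw [hx]
    simp [bdfGen, Finset.sum_Icc_succ_top]
    field_simp; ring

lemma differentiable_bdfGen (k : ℕ) : Differentiable ℂ (bdfGen k) := by
  unfold bdfGen; fun_prop

lemma bdfGen_div_multiplier_re {k : ℕ} (hk₁ : 1 ≤ k) (hk₆ : k ≤ 6) {ζ : ℂ} (h : ‖ζ‖ < 1) :
    0 < (bdfGen k ζ / bdfMultiplier ζ).re := by
  have hre : ζ.re < 1 := (Complex.re_le_norm ζ).trans_lt h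
  suffices hs : 3 / 117 ^ 2 * (1 - ζ.re) ≤ (bdfGen k ζ / bdfMultiplier ζ).re by
    have : 0 < 3 / 117 ^ 2 * (1 - ζ.re) := mul_pos (by norm_num) (by linarith)
    linarith
  have hd : DifferentiableOn ℂ (fun z => Complex.exp (3 / 117 ^ 2 * (1 - z)
      - bdfGen k z / bdfMultiplier z)) (Metric.closedBall 0 1) := by
    intro z hz
    have hz' : bdfMultiplier z ≠ 0 := bdfMultiplier_ne_zero (by simpa using hz)
    have h1 : DifferentiableAt ℂ bdfMultiplier z := by unfold bdfMultiplier; fun_prop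
    have h2 := (differentiable_bdfGen k) z
    exact (by fun_prop (disch := assumption) : DifferentiableAt ℂ _ z).differentiableWithinAt
  have hre : ∀ z : ℂ, (3 / 117 ^ 2 * (1 - z) - bdfGen k z / bdfMultiplier z).re
      = 3 / 117 ^ 2 * (1 - z.re) - (bdfGen k z / bdfMultiplier z).re := fun z => by
    rw [Complex.sub_re, show (3 / 117 ^ 2 * (1 - z) : ℂ) = ((3 / 117 ^ 2 : ℝ) : ℂ) * (1 - z) by
      push_cast; ring, Complex.re_ofReal_mul]
    simp
  have hm := Complex.norm_le_of_forall_mem_frontier_norm_le (C := 1)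
    (Metric.isBounded_ball (x := (0 : ℂ)) (r := 1))
    (hd.diffContOnCl_ball subset_rfl) (fun z hz => ?_)
    (subset_closure (by simpa using h : ζ ∈ Metric.ball (0 : ℂ) 1))
  · rw [Complex.norm_exp, Real.exp_le_one_iff, hre] at hm
    linarith
  · rw [frontier_ball _ one_ne_zero] at hz
    have hz1 : ‖z‖ = 1 := by simpa using hz
    rw [Complex.norm_exp, Real.exp_le_one_iff, hre]
    have h1 := bdfGen_mul_conj_re hk₁ hk₆ hz1
    have h0 := norm_pos_iff.2 (bdfMultiplier_ne_zero hz1.le)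
    have h2 := norm_bdfMultiplier_le hz1.le
    have h3 : (bdfGen k z / bdfMultiplier z).re
        = (bdfGen k z * conj (bdfMultiplier z)).re / ‖bdfMultiplier z‖ ^ 2 := by
      rw [div_eq_mul_inv, Complex.inv_def, ← mul_assoc, Complex.re_mul_ofReal,
        Complex.normSq_eq_norm_sq, div_eq_mul_inv]
    have h4 : 0 ≤ 1 - z.re := by
      have := Complex.re_le_norm z; linarith
    rw [h3, sub_nonpos, le_div_iff₀ (by positivity)]
    refine le_trans ?_ h1
    have h5 : ‖bdfMultiplier z‖ ^ 2 ≤ 117 ^ 2 := by gcongr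
    calc 3 / 117 ^ 2 * (1 - z.re) * ‖bdfMultiplier z‖ ^ 2
        ≤ 3 / 117 ^ 2 * (1 - z.re) * 117 ^ 2 := by gcongr
      _ = _ := by ring

lemma bdfGen_mem_slitPlane {k : ℕ} (hk₁ : 1 ≤ k) (hk₆ : k ≤ 6) {ζ : ℂ} (h : ‖ζ‖ < 1) :
    bdfGen k ζ ∈ Complex.slitPlane := by
  by_contra hn
  rw [Complex.mem_slitPlane_iff] at hn
  push Not at hn
  have hp := bdfGen_div_multiplier_re hk₁ hk₆ h
  have h1 : bdfGen k ζ = (((bdfGen k ζ).re : ℝ) : ℂ) := Complex.ext (by simp) (by simp [hn.2])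
  rw [h1, div_eq_mul_inv, Complex.re_ofReal_mul, Complex.inv_re] at hp
  have := div_nonneg (bdfMultiplier_re_pos h.le).le (Complex.normSq_nonneg (bdfMultiplier ζ))
  nlinarith [hn.1]

lemma exists_mul_norm_le_norm_bdfGen {k : ℕ} (hk₁ : 1 ≤ k) (hk₆ : k ≤ 6) :
    ∃ c : ℝ, 0 < c ∧ ∀ ζ : ℂ, ‖ζ‖ < 1 → c * ‖1 - ζ‖ ≤ ‖bdfGen k ζ‖ := by
  set q : ℂ → ℂ := fun ζ => ∑ l ∈ Finset.Icc 1 k, (1 / (l : ℂ)) * (1 - ζ) ^ (l - 1)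
  have hq : ∀ ζ, bdfGen k ζ = (1 - ζ) * q ζ := fun ζ => by
    simp only [bdfGen, q, Finset.mul_sum]
    refine Finset.sum_congr rfl fun l hl => ?_
    obtain ⟨m, rfl⟩ := Nat.exists_eq_add_of_le' (Finset.mem_Icc.1 hl).1
    simp only [Nat.add_sub_cancel]
    ring
  have hne : ∀ ζ ∈ Metric.closedBall (0 : ℂ) 1, q ζ ≠ 0 := by
    intro ζ hζ h0
    have hδ : bdfGen k ζ = 0 := by rw [hq, h0, mul_zero]
    rcases lt_or_eq_of_le (show ‖ζ‖ ≤ 1 by simpa using hζ) with h | h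
    · have := bdfGen_mem_slitPlane hk₁ hk₆ h
      rw [hδ] at this
      exact Complex.zero_notMem_slitPlane this
    · have h1 := bdfGen_mul_conj_re hk₁ hk₆ h
      rw [hδ] at h1
      simp only [zero_mul, Complex.zero_re] at h1
      have h2 : ζ.re = 1 := le_antisymm (h ▸ Complex.re_le_norm ζ) (by linarith)
      have h3 : ζ = 1 := by
        have h4 := Complex.sq_norm ζ
        rw [Complex.normSq_apply, h, h2] at h4
        refine Complex.ext (by simp [h2]) ?_
        have : ζ.im * ζ.im = 0 := by linarith
        simpa using this
      subst h3
      have : q 1 = 1 := by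
        simp only [q, sub_self]
        rw [Finset.sum_eq_single_of_mem 1 (by simp [hk₁])]
        · simp
        · intro l hl hl1
          have : l - 1 ≠ 0 := by have := (Finset.mem_Icc.1 hl).1; omega
          simp [this]
      rw [this] at h0
      exact one_ne_zero h0
  have hcont : ContinuousOn (fun ζ => ‖q ζ‖) (Metric.closedBall 0 1) := by
    simp only [q]; fun_prop
  obtain ⟨z, hz, hmin⟩ := (isCompact_closedBall (0 : ℂ) 1).exists_isMinOn ⟨0, by simp⟩ hcont
  refine ⟨‖q z‖, norm_pos_iff.2 (hne z hz), fun ζ hζ => ?_⟩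
  rw [hq, norm_mul, mul_comm]
  gcongr
  exact hmin (by simpa using hζ.le)

section

open MeasureTheory intervalIntegral

/-- The `n`-th Taylor coefficient at the origin. -/
noncomputable def taylorCoeff (f : ℂ → ℂ) (n : ℕ) : ℂ := iteratedDeriv n f 0 / (n.factorial : ℂ)

lemma norm_taylorCoeff_le {f : ℂ → ℂ} {ρ : ℝ} (hρ : 0 < ρ)
    (hf : DifferentiableOn ℂ f (Metric.closedBall 0 ρ)) (n : ℕ) :
    ‖taylorCoeff f n‖ ≤
      ((2 * Real.pi)⁻¹ * ∫ θ in (0 : ℝ)..2 * Real.pi, ‖f (circleMap 0 ρ θ)‖) * ρ⁻¹ ^ n := by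
  lift ρ to NNReal using hρ.le
  have hp := hf.hasFPowerSeriesOnBall (by exact_mod_cast hρ)
  have h1 := hp.factorial_smul 1 n
  rw [← iteratedDeriv_eq_iteratedFDeriv] at h1
  have h2 : taylorCoeff f n = cauchyPowerSeries f 0 ρ n (fun _ => 1) := by
    rw [taylorCoeff, ← h1, nsmul_eq_mul, mul_div_cancel_left₀]
    exact_mod_cast n.factorial_ne_zero
  rw [h2]
  have h3 := norm_cauchyPowerSeries_le f 0 ρ n
  rw [abs_of_pos hρ] at h3
  refine le_trans ?_ h3
  exact ((cauchyPowerSeries f 0 ρ n).le_opNorm (fun _ => 1)).trans_eq (by simp)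

lemma le_norm_one_sub_circleMap {ρ θ : ℝ} (h₀ : 1 / 2 ≤ ρ) (h₁ : ρ < 1) (hθ : |θ| ≤ Real.pi) :
    (1 - ρ + |θ|) / 4 ≤ ‖1 - circleMap 0 ρ θ‖ := by
  have e : ‖1 - circleMap 0 ρ θ‖ ^ 2 = (1 - ρ) ^ 2 + 2 * ρ * (1 - Real.cos θ) := by
    rw [Complex.sq_norm, Complex.normSq_apply]
    simp [circleMap, Complex.exp_re, Complex.exp_im]
    nlinarith [Real.sin_sq_add_cos_sq θ]
  have hc := Real.cos_le_one_sub_mul_cos_sq hθ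
  have hπ : 2 / Real.pi ^ 2 ≥ 1 / 5 := by
    rw [ge_iff_le, div_le_div_iff₀ (by norm_num) (by positivity)]
    nlinarith [Real.pi_lt_d2, Real.pi_pos]
  have h5 : θ ^ 2 / 5 ≤ 1 - Real.cos θ := by nlinarith [sq_nonneg θ]
  refine le_of_sq_le_sq ?_ (norm_nonneg _)
  rw [e]
  have h6 : θ ^ 2 / 5 ≤ 2 * ρ * (1 - Real.cos θ) := by
    have := Real.cos_le_one θ
    nlinarith
  have h7 : |θ| ^ 2 = θ ^ 2 := sq_abs θ
  nlinarith [sq_nonneg (1 - ρ - |θ|), sq_nonneg (1 - ρ), sq_nonneg θ]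

lemma integral_add_rpow_le {ε s b : ℝ} (hε : 0 < ε) (hs : 0 < s) (hb : 0 ≤ b) :
    ∫ θ in (0 : ℝ)..b, (ε + θ) ^ (-1 - s) ≤ ε ^ (-s) / s := by
  rw [integral_comp_add_left (fun x => x ^ (-1 - s)) ε, integral_rpow]
  · rw [add_zero, show -1 - s + 1 = -s by ring, div_neg, ← neg_div, neg_sub]
    gcongr
    linarith [Real.rpow_nonneg (by linarith : 0 ≤ ε + b) (-s)]
  · refine Or.inr ⟨by linarith, fun h => ?_⟩
    rw [add_zero, Set.uIcc_of_le (by linarith)] at h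
    linarith [h.1]

lemma continuous_add_abs_rpow {ε : ℝ} (hε : 0 < ε) (r : ℝ) :
    Continuous fun θ : ℝ => (ε + |θ|) ^ r :=
  Continuous.rpow_const (by fun_prop) fun θ => Or.inl (by positivity)

lemma integral_add_abs_rpow_le {ε s b : ℝ} (hε : 0 < ε) (hs : 0 < s) (hb : 0 ≤ b) :
    ∫ θ in (-b)..b, (ε + |θ|) ^ (-1 - s) ≤ 2 * (ε ^ (-s) / s) := by
  have hi : ∀ a c, IntervalIntegrable (fun θ : ℝ => (ε + |θ|) ^ (-1 - s)) volume a c :=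
    fun a c => (continuous_add_abs_rpow hε _).intervalIntegrable _ _
  rw [← integral_add_adjacent_intervals (hi (-b) 0) (hi 0 b)]
  have h1 : ∫ θ in (-b)..0, (ε + |θ|) ^ (-1 - s) = ∫ θ in (0 : ℝ)..b, (ε + |θ|) ^ (-1 - s) := by
    have := integral_comp_neg (a := 0) (b := b) (fun θ : ℝ => (ε + |θ|) ^ (-1 - s))
    simp only [abs_neg, neg_zero] at this
    exact this.symm
  have h2 : ∫ θ in (0 : ℝ)..b, (ε + |θ|) ^ (-1 - s) = ∫ θ in (0 : ℝ)..b, (ε + θ) ^ (-1 - s) :=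
    integral_congr fun θ hθ => by
      rw [Set.uIcc_of_le hb] at hθ
      simp only [abs_of_nonneg hθ.1]
  rw [h1, h2]
  linarith [integral_add_rpow_le hε hs hb]

lemma integral_norm_one_sub_circleMap_rpow_le {ρ s : ℝ} (hs : 0 < s) (h₀ : 1 / 2 ≤ ρ)
    (h₁ : ρ < 1) :
    ∫ θ in (0 : ℝ)..2 * Real.pi, ‖1 - circleMap 0 ρ θ‖ ^ (-1 - s)
      ≤ 4 ^ (1 + s) * (2 * ((1 - ρ) ^ (-s) / s)) := by
  have hper : Function.Periodic (fun θ : ℝ => ‖1 - circleMap 0 ρ θ‖ ^ (-1 - s))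
      (2 * Real.pi) := fun θ => by simp only [periodic_circleMap 0 ρ θ]
  have h1 := hper.intervalIntegral_add_eq 0 (-Real.pi)
  rw [zero_add, show -Real.pi + 2 * Real.pi = Real.pi by ring] at h1
  have hε : 0 < 1 - ρ := by linarith
  rw [h1]
  have hne : ∀ θ, 0 < ‖1 - circleMap 0 ρ θ‖ := fun θ => by
    rw [norm_pos_iff, sub_ne_zero]
    intro h
    have : ‖circleMap 0 ρ θ‖ = |ρ| := by simp
    rw [← h, abs_of_pos (by linarith)] at this
    simp at this
    linarith
  calc _ ≤ ∫ θ in (-Real.pi)..Real.pi, 4 ^ (1 + s) * (1 - ρ + |θ|) ^ (-1 - s) := by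
        refine integral_mono_on (by linarith [Real.pi_pos])
          (Continuous.intervalIntegrable ?_ _ _)
          (Continuous.intervalIntegrable ?_ _ _) fun θ hθ => ?_
        · exact Continuous.rpow_const (by fun_prop) fun θ => Or.inl (hne θ).ne'
        · exact (continuous_add_abs_rpow hε _).const_mul _
        · have h2 := le_norm_one_sub_circleMap h₀ h₁ (abs_le.2 hθ)
          have h3 : 0 < (1 - ρ + |θ|) / 4 := by positivity
          calc ‖1 - circleMap 0 ρ θ‖ ^ (-1 - s) ≤ ((1 - ρ + |θ|) / 4) ^ (-1 - s) :=
                Real.rpow_le_rpow_of_nonpos h3 h2 (by linarith)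
            _ = _ := by
              rw [Real.div_rpow (by positivity) (by norm_num), show 1 + s = -(-1 - s) by ring,
                Real.rpow_neg (by norm_num) (-1 - s), div_eq_mul_inv, mul_comm]
    _ ≤ _ := by
        rw [intervalIntegral.integral_const_mul]
        gcongr
        exact integral_add_abs_rpow_le hε hs Real.pi_pos.le

lemma exists_norm_taylorCoeff_le {s : ℝ} (hs : 0 < s) :
    ∃ C : ℝ, 0 < C ∧ ∀ (h : ℂ → ℂ) (K : ℝ), 0 ≤ K → DifferentiableOn ℂ h (Metric.ball 0 1) →
      (∀ z : ℂ, ‖z‖ < 1 → ‖h z‖ ≤ K * ‖1 - z‖ ^ (-1 - s)) →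
      ∀ n : ℕ, ‖taylorCoeff h n‖ ≤ C * K * ((n : ℝ) + 1) ^ s := by
  refine ⟨(2 * Real.pi)⁻¹ * (4 ^ (1 + s) * (2 * (2 ^ s / s))) * Real.exp 1, by positivity, ?_⟩
  intro h K hK hd hb n
  set ρ : ℝ := ((n : ℝ) + 1) / (n + 2) with hρ
  have h1ρ : 1 - ρ = ((n : ℝ) + 2)⁻¹ := by rw [hρ]; field_simp; ring
  have h₁ : ρ < 1 := by
    have : 0 < 1 - ρ := by rw [h1ρ]; positivity
    linarith
  have h₀ : 1 / 2 ≤ ρ := by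
    rw [hρ, div_le_div_iff₀ (by norm_num) (by positivity)]; linarith
  have hsub : Metric.closedBall (0 : ℂ) ρ ⊆ Metric.ball 0 1 := Metric.closedBall_subset_ball h₁
  have hρ0 : 0 < ρ := by linarith
  refine (norm_taylorCoeff_le hρ0 (hd.mono hsub) n).trans ?_
  have hmem : ∀ θ, circleMap 0 ρ θ ∈ Metric.ball (0 : ℂ) 1 := fun θ => by
    simpa [abs_of_pos hρ0] using h₁
  have hint : ∫ θ in (0 : ℝ)..2 * Real.pi, ‖h (circleMap 0 ρ θ)‖
      ≤ K * (4 ^ (1 + s) * (2 * ((1 - ρ) ^ (-s) / s))) := by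
    calc _ ≤ ∫ θ in (0 : ℝ)..2 * Real.pi, K * ‖1 - circleMap 0 ρ θ‖ ^ (-1 - s) := by
          refine integral_mono_on (by positivity)
            (Continuous.intervalIntegrable ?_ _ _)
            (Continuous.intervalIntegrable ?_ _ _) fun θ hθ => ?_
          · exact (hd.continuousOn.comp_continuous (continuous_circleMap 0 ρ) hmem).norm
          · refine (Continuous.rpow_const (by fun_prop) fun θ => Or.inl ?_).const_mul _
            rw [norm_ne_zero_iff, sub_ne_zero]
            intro h
            have := hmem θ
            rw [← h] at this
            simp at this
          · exact hb _ (by simpa using hmem θ)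
      _ ≤ _ := by
          rw [intervalIntegral.integral_const_mul]
          gcongr
          exact integral_norm_one_sub_circleMap_rpow_le hs h₀ h₁
  have hpow : ρ⁻¹ ^ n ≤ Real.exp 1 := by
    have h2 : ρ⁻¹ = ((n : ℝ) + 1)⁻¹ + 1 := by rw [hρ]; field_simp; ring
    rw [h2]
    calc _ ≤ (Real.exp ((n : ℝ) + 1)⁻¹) ^ n := by
          gcongr; exact Real.add_one_le_exp _
      _ = Real.exp (n * ((n : ℝ) + 1)⁻¹) := (Real.exp_nat_mul _ _).symm
      _ ≤ Real.exp 1 := by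
          gcongr
          rw [mul_inv_le_iff₀ (by positivity)]; linarith
  have hs1 : (1 - ρ) ^ (-s) ≤ 2 ^ s * ((n : ℝ) + 1) ^ s := by
    rw [h1ρ, Real.inv_rpow (by positivity), Real.rpow_neg (by positivity), inv_inv,
      ← Real.mul_rpow (by norm_num) (by positivity)]
    gcongr; linarith
  calc _ ≤ ((2 * Real.pi)⁻¹ * (K * (4 ^ (1 + s) * (2 * ((2 ^ s * ((n : ℝ) + 1) ^ s) / s)))))
        * Real.exp 1 := by
        gcongr
        exact hint.trans (by gcongr)
    _ = _ := by ring

end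

lemma taylorCoeff_succ (f : ℂ → ℂ) (n : ℕ) :
    taylorCoeff f (n + 1) = taylorCoeff (deriv f) n / ((n : ℂ) + 1) := by
  rw [taylorCoeff, taylorCoeff, iteratedDeriv_succ', Nat.factorial_succ, div_div]
  push_cast
  rw [mul_comm ((n : ℂ) + 1)]

lemma norm_taylorCoeff_succ (f : ℂ → ℂ) (n : ℕ) :
    ‖taylorCoeff f (n + 1)‖ = ‖taylorCoeff (deriv f) n‖ / ((n : ℝ) + 1) := by
  rw [taylorCoeff_succ, norm_div]
  congr 1
  rw [← Nat.cast_succ, Complex.norm_natCast, Nat.cast_succ]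

lemma taylorCoeff_mul {f g : ℂ → ℂ} {n : ℕ} (hf : ContDiffAt ℂ n f 0) (hg : ContDiffAt ℂ n g 0) :
    taylorCoeff (f * g) n
      = ∑ i ∈ Finset.range (n + 1), taylorCoeff f i * taylorCoeff g (n - i) := by
  rw [taylorCoeff, iteratedDeriv_mul hf hg, Finset.sum_div]
  refine Finset.sum_congr rfl fun i hi => ?_
  have hi' : i ≤ n := Nat.lt_succ_iff.1 (Finset.mem_range.1 hi)
  rw [taylorCoeff, taylorCoeff, Nat.cast_choose ℂ hi']
  have h1 : (n.factorial : ℂ) ≠ 0 := by exact_mod_cast n.factorial_ne_zero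
  field_simp

lemma norm_cpow_ofReal {z : ℂ} (hz : z ≠ 0) (r : ℝ) : ‖z ^ (r : ℂ)‖ = ‖z‖ ^ r := by
  rw [Complex.norm_cpow_of_ne_zero hz]; simp

/-- Fractional powers of exponent `α < 1` stay in a closed sector avoiding the negative axis. -/
lemma sin_mul_norm_cpow_le {α : ℝ} (hα₀ : 0 < α) (hα₁ : α < 1) {z : ℂ} (hz : z ≠ 0) {l : ℝ}
    (hl : 0 ≤ l) : Real.sin (Real.pi * α) * ‖z‖ ^ α ≤ ‖z ^ (α : ℂ) + l‖ := by
  refine le_of_sq_le_sq ?_ (norm_nonneg _)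
  have hre : ‖z‖ ^ α * Real.cos (Real.pi * α) ≤ (z ^ (α : ℂ)).re := by
    rw [Complex.cpow_ofReal_re]
    gcongr
    rw [← Real.cos_abs (z.arg * α), abs_mul, abs_of_pos hα₀]
    refine Real.cos_le_cos_of_nonneg_of_le_pi (by positivity) ?_ ?_
    · nlinarith [Real.pi_pos]
    · gcongr
      exact Complex.abs_arg_le_pi z
  have e : ‖z ^ (α : ℂ) + l‖ ^ 2 = (‖z‖ ^ α) ^ 2 + 2 * l * (z ^ (α : ℂ)).re + l ^ 2 := by
    rw [← norm_cpow_ofReal hz, Complex.sq_norm, Complex.sq_norm, Complex.normSq_apply,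
      Complex.normSq_apply]
    simp
    ring
  rw [e, mul_pow, Real.sin_sq]
  nlinarith [sq_nonneg (‖z‖ ^ α * Real.cos (Real.pi * α) + l), mul_le_mul_of_nonneg_left hre hl]

section Symbol

variable {α : ℝ} {k : ℕ}

/-- The generating function of the convolution quadrature weights. -/
noncomputable def cqSymbol (α : ℝ) (k : ℕ) (ξ : ℂ) : ℂ := bdfGen k ξ ^ (α : ℂ)

lemma cqWeight_eq_taylorCoeff (n : ℕ) : cqWeight α k n = taylorCoeff (cqSymbol α k) n := rfl

lemma hasDerivAt_bdfGen_cpow (hk₁ : 1 ≤ k) (hk₆ : k ≤ 6) (s : ℂ) {z : ℂ} (hz : ‖z‖ < 1) :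
    HasDerivAt (fun ξ => bdfGen k ξ ^ s) (s * bdfGen k z ^ (s - 1) * deriv (bdfGen k) z) z :=
  (differentiable_bdfGen k z).hasDerivAt.cpow_const (bdfGen_mem_slitPlane hk₁ hk₆ hz)

lemma differentiableOn_cqSymbol (hk₁ : 1 ≤ k) (hk₆ : k ≤ 6) :
    DifferentiableOn ℂ (cqSymbol α k) (Metric.ball 0 1) := fun _ hz =>
  (hasDerivAt_bdfGen_cpow hk₁ hk₆ α (by simpa using hz)).differentiableAt.differentiableWithinAt

lemma deriv_cqSymbol (hk₁ : 1 ≤ k) (hk₆ : k ≤ 6) {z : ℂ} (hz : ‖z‖ < 1) :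
    deriv (cqSymbol α k) z = α * bdfGen k z ^ ((α : ℂ) - 1) * deriv (bdfGen k) z :=
  (hasDerivAt_bdfGen_cpow hk₁ hk₆ α hz).deriv

lemma differentiable_deriv_bdfGen (k : ℕ) : Differentiable ℂ (deriv (bdfGen k)) := by
  have h := (differentiable_bdfGen k).differentiableOn (s := Set.univ)
  exact differentiableOn_univ.1 (h.deriv isOpen_univ)

lemma deriv_deriv_cqSymbol (hk₁ : 1 ≤ k) (hk₆ : k ≤ 6) {z : ℂ} (hz : ‖z‖ < 1) :
    deriv (deriv (cqSymbol α k)) z =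
      α * (((α : ℂ) - 1) * bdfGen k z ^ ((α : ℂ) - 2) * deriv (bdfGen k) z ^ 2
        + bdfGen k z ^ ((α : ℂ) - 1) * deriv (deriv (bdfGen k)) z) := by
  have he : deriv (cqSymbol α k) =ᶠ[nhds z]
      fun z => α * bdfGen k z ^ ((α : ℂ) - 1) * deriv (bdfGen k) z := by
    filter_upwards [Metric.isOpen_ball.mem_nhds (by simpa using hz : z ∈ Metric.ball (0 : ℂ) 1)]
      with w hw using deriv_cqSymbol hk₁ hk₆ (by simpa using hw)
  rw [he.deriv_eq]
  have h1 := ((hasDerivAt_bdfGen_cpow hk₁ hk₆ ((α : ℂ) - 1) hz).const_mul (α : ℂ)).mul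
    (differentiable_deriv_bdfGen k z).hasDerivAt
  refine h1.deriv.trans ?_
  rw [show (α : ℂ) - 1 - 1 = α - 2 by ring]
  ring

lemma exists_norm_deriv_bdfGen_le (k : ℕ) : ∃ B : ℝ, 0 < B ∧ ∀ z : ℂ, ‖z‖ < 1 →
    ‖deriv (bdfGen k) z‖ ≤ B ∧ ‖deriv (deriv (bdfGen k)) z‖ ≤ B := by
  have h2 : Continuous (deriv (deriv (bdfGen k))) := by
    have h := (differentiable_deriv_bdfGen k).differentiableOn (s := Set.univ)
    exact (differentiableOn_univ.1 (h.deriv isOpen_univ)).continuous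
  obtain ⟨a, ha⟩ := (isCompact_closedBall (0 : ℂ) 1).exists_bound_of_continuousOn
    (differentiable_deriv_bdfGen k).continuous.continuousOn
  obtain ⟨b, hb⟩ := (isCompact_closedBall (0 : ℂ) 1).exists_bound_of_continuousOn h2.continuousOn
  refine ⟨max 1 (max a b), by positivity, fun z hz => ?_⟩
  have hm : z ∈ Metric.closedBall (0 : ℂ) 1 := by simpa using hz.le
  exact ⟨(ha z hm).trans (by simp), (hb z hm).trans (by simp)⟩

lemma bdfGen_ne_zero (hk₁ : 1 ≤ k) (hk₆ : k ≤ 6) {z : ℂ} (hz : ‖z‖ < 1) : bdfGen k z ≠ 0 :=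
  Complex.slitPlane_ne_zero (bdfGen_mem_slitPlane hk₁ hk₆ hz)

lemma one_sub_norm_pos {z : ℂ} (hz : ‖z‖ < 1) : 0 < ‖1 - z‖ := by
  rw [norm_pos_iff, sub_ne_zero]
  rintro rfl
  simp at hz

lemma exists_norm_deriv_deriv_cqSymbol_le (hα₀ : 0 < α) (hα₁ : α < 1) (hk₁ : 1 ≤ k)
    (hk₆ : k ≤ 6) : ∃ K : ℝ, 0 < K ∧ ∀ z : ℂ, ‖z‖ < 1 →
      ‖deriv (deriv (cqSymbol α k)) z‖ ≤ K * ‖1 - z‖ ^ (-1 - (1 - α)) := by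
  obtain ⟨B, hB, hBz⟩ := exists_norm_deriv_bdfGen_le k
  obtain ⟨c, hc, hcz⟩ := exists_mul_norm_le_norm_bdfGen hk₁ hk₆
  refine ⟨c ^ (α - 2) * B ^ 2 + c ^ (α - 1) * 2 * B, by positivity, fun z hz => ?_⟩
  have hδ := bdfGen_ne_zero hk₁ hk₆ hz
  have h1 := one_sub_norm_pos hz
  have hpow : ∀ r : ℝ, r ≤ 0 → ‖bdfGen k z ^ (r : ℂ)‖ ≤ c ^ r * ‖1 - z‖ ^ r := fun r hr => by
    rw [norm_cpow_ofReal hδ, ← Real.mul_rpow hc.le h1.le]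
    exact Real.rpow_le_rpow_of_nonpos (by positivity) (hcz z hz) hr
  have ha := hpow (α - 2) (by linarith)
  have hb := hpow (α - 1) (by linarith)
  push_cast at ha hb
  have h2 : ‖1 - z‖ ≤ 2 := (norm_sub_le _ _).trans (by simp; linarith)
  have h3 : ‖1 - z‖ ^ (α - 1) ≤ 2 * ‖1 - z‖ ^ (α - 2) := by
    rw [show α - 1 = 1 + (α - 2) by ring, Real.rpow_add h1, Real.rpow_one]
    gcongr
  obtain ⟨hB1, hB2⟩ := hBz z hz
  have hn1 : ‖(α : ℂ)‖ ≤ 1 := by rw [Complex.norm_real, Real.norm_of_nonneg hα₀.le]; exact hα₁.le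
  have hn2 : ‖(α : ℂ) - 1‖ ≤ 1 := by
    rw [← Complex.ofReal_one, ← Complex.ofReal_sub, Complex.norm_real, Real.norm_eq_abs, abs_le]
    constructor <;> linarith
  rw [deriv_deriv_cqSymbol hk₁ hk₆ hz, norm_mul, show -1 - (1 - α) = α - 2 by ring]
  calc _ ≤ 1 * (1 * (c ^ (α - 2) * ‖1 - z‖ ^ (α - 2)) * B ^ 2
        + (c ^ (α - 1) * ‖1 - z‖ ^ (α - 1)) * B) := by
        gcongr
        refine (norm_add_le _ _).trans ?_
        rw [norm_mul, norm_mul, norm_mul, norm_pow]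
        gcongr
    _ ≤ 1 * (1 * (c ^ (α - 2) * ‖1 - z‖ ^ (α - 2)) * B ^ 2
        + (c ^ (α - 1) * (2 * ‖1 - z‖ ^ (α - 2))) * B) := by gcongr
    _ = _ := by ring

lemma exists_norm_cqWeight_le (hα₀ : 0 < α) (hα₁ : α < 1) (hk₁ : 1 ≤ k) (hk₆ : k ≤ 6) :
    ∃ C : ℝ, 0 < C ∧ ∀ n : ℕ, ‖cqWeight α k n‖ ≤ C * ((n : ℝ) + 1) ^ (-1 - α) := by
  obtain ⟨K, hK, hKz⟩ := exists_norm_deriv_deriv_cqSymbol_le hα₀ hα₁ hk₁ hk₆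
  obtain ⟨C, hC, hCn⟩ := exists_norm_taylorCoeff_le (s := 1 - α) (by linarith)
  have hd := ((differentiableOn_cqSymbol (α := α) hk₁ hk₆).deriv Metric.isOpen_ball).deriv
    Metric.isOpen_ball
  have hb := hCn _ K hK.le hd hKz
  refine ⟨‖cqWeight α k 0‖ + ‖cqWeight α k 1‖ * 2 ^ (1 + α) + C * K * 3 ^ (1 + α),
    by positivity, fun n => ?_⟩
  match n with
  | 0 =>
    simp only [Nat.cast_zero, zero_add, Real.one_rpow, mul_one]
    have : 0 ≤ ‖cqWeight α k 1‖ * 2 ^ (1 + α) + C * K * 3 ^ (1 + α) := by positivity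
    linarith
  | 1 =>
    have h2 : (2 : ℝ) ^ (1 + α) * ((1 : ℕ) + 1 : ℝ) ^ (-1 - α) = 1 := by
      rw [Nat.cast_one, one_add_one_eq_two, ← Real.rpow_add (by norm_num)]
      ring_nf; simp
    have h3 : 0 ≤ (‖cqWeight α k 0‖ + C * K * 3 ^ (1 + α)) * ((1 : ℕ) + 1 : ℝ) ^ (-1 - α) := by
      positivity
    nlinarith [congrArg (‖cqWeight α k 1‖ * ·) h2]
  | n + 2 =>
    rw [cqWeight_eq_taylorCoeff, norm_taylorCoeff_succ, norm_taylorCoeff_succ]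
    have hn : (0 : ℝ) < (n : ℝ) + 1 := by positivity
    have h1 : ((n : ℝ) + 1) ^ (1 - α) = ((n : ℝ) + 1) ^ (-1 - α) * ((n : ℝ) + 1) ^ 2 := by
      rw [← Real.rpow_natCast, ← Real.rpow_add hn]; congr 1; ring
    have h2 : ((n : ℝ) + 1) ^ (-1 - α) ≤ 3 ^ (1 + α) * (((n + 2 : ℕ) : ℝ) + 1) ^ (-1 - α) := by
      rw [show (1 + α) = -(-1 - α) by ring, Real.rpow_neg (by norm_num) (-1 - α), ← div_eq_inv_mul,
        ← Real.div_rpow (by positivity) (by norm_num)]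
      refine Real.rpow_le_rpow_of_nonpos (by positivity) ?_ (by linarith)
      push_cast; linarith
    calc _ ≤ C * K * ((n : ℝ) + 1) ^ (1 - α) / ((n : ℝ) + 1) / ((n : ℝ) + 1) := by
          gcongr
          · exact hb n
          · linarith
      _ = C * K * ((n : ℝ) + 1) ^ (-1 - α) := by rw [h1]; field_simp
      _ ≤ C * K * (3 ^ (1 + α) * (((n + 2 : ℕ) : ℝ) + 1) ^ (-1 - α)) := by gcongr
      _ ≤ _ := by
        have : 0 ≤ (‖cqWeight α k 0‖ + ‖cqWeight α k 1‖ * 2 ^ (1 + α))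
          * (((n + 2 : ℕ) : ℝ) + 1) ^ (-1 - α) := by positivity
        linarith

/-- The generating function of the discrete resolvent kernel of the scalar problem. -/
noncomputable def cqResolvent (α : ℝ) (k : ℕ) (l : ℝ) (ξ : ℂ) : ℂ := (cqSymbol α k ξ + l)⁻¹

lemma sin_pi_mul_pos (hα₀ : 0 < α) (hα₁ : α < 1) : 0 < Real.sin (Real.pi * α) :=
  Real.sin_pos_of_pos_of_lt_pi (by have := Real.pi_pos; positivity)
    (by nlinarith [Real.pi_pos])

lemma cqSymbol_add_ne_zero (hα₀ : 0 < α) (hα₁ : α < 1) (hk₁ : 1 ≤ k) (hk₆ : k ≤ 6) {l : ℝ}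
    (hl : 0 ≤ l) {z : ℂ} (hz : ‖z‖ < 1) : cqSymbol α k z + l ≠ 0 := by
  have h0 := bdfGen_ne_zero hk₁ hk₆ hz
  have h1 := sin_pi_mul_pos hα₀ hα₁
  have h2 : 0 < ‖bdfGen k z‖ := norm_pos_iff.2 h0
  have := sin_mul_norm_cpow_le hα₀ hα₁ h0 hl
  rw [← norm_pos_iff]
  exact lt_of_lt_of_le (by positivity) this

lemma differentiableOn_cqResolvent (hα₀ : 0 < α) (hα₁ : α < 1) (hk₁ : 1 ≤ k) (hk₆ : k ≤ 6)
    {l : ℝ} (hl : 0 ≤ l) : DifferentiableOn ℂ (cqResolvent α k l) (Metric.ball 0 1) :=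
  ((differentiableOn_cqSymbol hk₁ hk₆).add_const _).inv fun _ hz =>
    cqSymbol_add_ne_zero hα₀ hα₁ hk₁ hk₆ hl (by simpa using hz)

lemma exists_norm_deriv_cqResolvent_le (hα₀ : 0 < α) (hα₁ : α < 1) (hk₁ : 1 ≤ k)
    (hk₆ : k ≤ 6) : ∃ K : ℝ, 0 < K ∧ ∀ l : ℝ, 0 ≤ l → ∀ z : ℂ, ‖z‖ < 1 →
      ‖deriv (cqResolvent α k l) z‖ ≤ K * ‖1 - z‖ ^ (-1 - α) := by
  obtain ⟨B, hB, hBz⟩ := exists_norm_deriv_bdfGen_le k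
  obtain ⟨c, hc, hcz⟩ := exists_mul_norm_le_norm_bdfGen hk₁ hk₆
  have hs := sin_pi_mul_pos hα₀ hα₁
  set S := Real.sin (Real.pi * α)
  refine ⟨B / S ^ 2 * c ^ (-1 - α), by positivity, fun l hl z hz => ?_⟩
  have hδ := bdfGen_ne_zero hk₁ hk₆ hz
  have hδ' : 0 < ‖bdfGen k z‖ := norm_pos_iff.2 hδ
  have h1 := one_sub_norm_pos hz
  have hne := cqSymbol_add_ne_zero hα₀ hα₁ hk₁ hk₆ hl hz
  have hd : HasDerivAt (cqResolvent α k l) _ z :=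
    ((hasDerivAt_bdfGen_cpow hk₁ hk₆ α hz).add_const (l : ℂ)).inv hne
  rw [hd.deriv, norm_div, norm_neg, norm_mul, norm_mul, norm_pow]
  have hp : ‖bdfGen k z ^ ((α : ℂ) - 1)‖ = ‖bdfGen k z‖ ^ (α - 1) := by
    rw [← norm_cpow_ofReal hδ]; push_cast; rfl
  have hn1 : ‖(α : ℂ)‖ ≤ 1 := by rw [Complex.norm_real, Real.norm_of_nonneg hα₀.le]; exact hα₁.le
  rw [hp]
  calc _ ≤ 1 * ‖bdfGen k z‖ ^ (α - 1) * B / (S * ‖bdfGen k z‖ ^ α) ^ 2 := by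
        gcongr
        · exact (hBz z hz).1
        · exact sin_mul_norm_cpow_le hα₀ hα₁ hδ hl
    _ = B / S ^ 2 * ‖bdfGen k z‖ ^ (-1 - α) := by
        rw [mul_pow, ← Real.rpow_natCast (‖bdfGen k z‖ ^ α), ← Real.rpow_mul hδ'.le,
          show α - 1 = (-1 - α) + α * (2 : ℕ) by push_cast; ring, Real.rpow_add hδ']
        field_simp
    _ ≤ B / S ^ 2 * (c * ‖1 - z‖) ^ (-1 - α) :=
        mul_le_mul_of_nonneg_left
          (Real.rpow_le_rpow_of_nonpos (by positivity) (hcz z hz) (by linarith)) (by positivity)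
    _ = _ := by rw [Real.mul_rpow hc.le h1.le]; ring

lemma exists_norm_taylorCoeff_cqResolvent_le (hα₀ : 0 < α) (hα₁ : α < 1) (hk₁ : 1 ≤ k)
    (hk₆ : k ≤ 6) : ∃ C : ℝ, 0 < C ∧ ∀ l : ℝ, 0 ≤ l → ∀ n : ℕ,
      ‖taylorCoeff (cqResolvent α k l) n‖ ≤ C * ((n : ℝ) + 1) ^ (α - 1) := by
  obtain ⟨K, hK, hKz⟩ := exists_norm_deriv_cqResolvent_le hα₀ hα₁ hk₁ hk₆
  obtain ⟨C, hC, hCn⟩ := exists_norm_taylorCoeff_le hα₀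
  have hs := sin_pi_mul_pos hα₀ hα₁
  have h0 : bdfGen k 0 ≠ 0 := bdfGen_ne_zero hk₁ hk₆ (by simp)
  have h0' : 0 < ‖bdfGen k 0‖ := norm_pos_iff.2 h0
  set D := (Real.sin (Real.pi * α) * ‖bdfGen k 0‖ ^ α)⁻¹
  have hD : 0 < D := by positivity
  refine ⟨D + C * K * 2 ^ (1 - α), by positivity, fun l hl n => ?_⟩
  match n with
  | 0 =>
    have h1 : ‖taylorCoeff (cqResolvent α k l) 0‖ ≤ D := by
      simp only [taylorCoeff, iteratedDeriv_zero, Nat.factorial_zero, Nat.cast_one, div_one,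
        cqResolvent, norm_inv, D]
      gcongr
      exact sin_mul_norm_cpow_le hα₀ hα₁ h0 hl
    simp only [Nat.cast_zero, zero_add, Real.one_rpow, mul_one]
    have : 0 ≤ C * K * 2 ^ (1 - α) := by positivity
    linarith
  | n + 1 =>
    rw [norm_taylorCoeff_succ]
    have hb := hCn _ K hK.le ((differentiableOn_cqResolvent hα₀ hα₁ hk₁ hk₆ hl).deriv
      Metric.isOpen_ball) (hKz l hl) n
    have h2 : ((n : ℝ) + 1) ^ (α - 1) ≤ 2 ^ (1 - α) * (((n + 1 : ℕ) : ℝ) + 1) ^ (α - 1) := by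
      rw [show (1 - α) = -(α - 1) by ring, Real.rpow_neg (by norm_num) (α - 1), ← div_eq_inv_mul,
        ← Real.div_rpow (by positivity) (by norm_num)]
      refine Real.rpow_le_rpow_of_nonpos (by positivity) ?_ (by linarith)
      push_cast; linarith
    calc _ ≤ C * K * ((n : ℝ) + 1) ^ α / ((n : ℝ) + 1) := by gcongr
      _ = C * K * ((n : ℝ) + 1) ^ (α - 1) := by
        rw [Real.rpow_sub_one (by positivity)]; ring
      _ ≤ C * K * (2 ^ (1 - α) * (((n + 1 : ℕ) : ℝ) + 1) ^ (α - 1)) := by gcongr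
      _ ≤ _ := by
        have : 0 ≤ D * (((n + 1 : ℕ) : ℝ) + 1) ^ (α - 1) := by positivity
        linarith

end Symbol

/-- The discrete resolvent kernel: for `b = (ω 0 + B)⁻¹`, the coefficients of the inverse of the
power series `∑ ω j ζ ^ j + B`. -/
def resolventSeq {R : Type*} [Ring R] [Algebra ℂ R] (w : ℕ → ℂ) (b : R) : ℕ → R
  | 0 => b
  | n + 1 => -(b * ∑ j : Fin (n + 1), w (j + 1) • resolventSeq w b (n - j))

section ResolventSeq

variable {R : Type*} [Ring R] [Algebra ℂ R] (w : ℕ → ℂ)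

lemma resolventSeq_zero (b : R) : resolventSeq w b 0 = b := by rw [resolventSeq]

lemma resolventSeq_succ (b : R) (n : ℕ) : resolventSeq w b (n + 1)
    = -(b * ∑ j ∈ Finset.range (n + 1), w (j + 1) • resolventSeq w b (n - j)) := by
  rw [resolventSeq, Finset.sum_range]

lemma map_resolventSeq {S : Type*} [Ring S] [Algebra ℂ S] (φ : R →ₐ[ℂ] S) (b : R) (n : ℕ) :
    φ (resolventSeq w b n) = resolventSeq w (φ b) n := by
  induction n using Nat.strong_induction_on with
  | _ n ih =>
    cases n with
    | zero => simp [resolventSeq_zero]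
    | succ n =>
      rw [resolventSeq_succ, resolventSeq_succ, map_neg, map_mul, map_sum]
      congr 2
      refine Finset.sum_congr rfl fun j _ => ?_
      rw [map_smul, ih _ (by omega)]

lemma resolventSeq_of_zero (n : ℕ) : resolventSeq w (0 : R) n = 0 := by
  cases n with
  | zero => exact resolventSeq_zero _ _
  | succ n => rw [resolventSeq_succ, zero_mul, neg_zero]

end ResolventSeq

lemma taylorCoeff_cqResolvent_eq {α : ℝ} {k : ℕ} (hα₀ : 0 < α) (hα₁ : α < 1) (hk₁ : 1 ≤ k)
    (hk₆ : k ≤ 6) {l : ℝ} (hl : 0 ≤ l) (n : ℕ) :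
    taylorCoeff (cqResolvent α k l) n
      = resolventSeq (cqWeight α k) (cqWeight α k 0 + l)⁻¹ n := by
  have hball : Metric.ball (0 : ℂ) 1 ∈ nhds 0 := Metric.ball_mem_nhds _ one_pos
  have hr : ∀ n : ℕ, ContDiffAt ℂ n (cqResolvent α k l) 0 := fun n =>
    (((differentiableOn_cqResolvent hα₀ hα₁ hk₁ hk₆ hl).contDiffOn
      Metric.isOpen_ball).contDiffAt hball)
  have hs : ∀ n : ℕ, ContDiffAt ℂ n (cqSymbol α k) 0 := fun n =>
    (((differentiableOn_cqSymbol hk₁ hk₆).contDiffOn Metric.isOpen_ball).contDiffAt hball)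
  have h0 : cqWeight α k 0 = cqSymbol α k 0 := by simp [cqWeight, cqSymbol]
  have hne : cqWeight α k 0 + l ≠ 0 := by
    rw [h0]; exact cqSymbol_add_ne_zero hα₀ hα₁ hk₁ hk₆ hl (by simp)
  have hone : ∀ n : ℕ, taylorCoeff (cqSymbol α k * cqResolvent α k l) (n + 1)
      = -(l * taylorCoeff (cqResolvent α k l) (n + 1)) := fun n => by
    have he : cqSymbol α k * cqResolvent α k l =ᶠ[nhds 0]
        fun z => 1 - l * cqResolvent α k l z := by
      filter_upwards [hball] with z hz
      have := cqSymbol_add_ne_zero hα₀ hα₁ hk₁ hk₆ hl (z := z) (by simpa using hz)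
      simp only [Pi.mul_apply, cqResolvent]
      field_simp
      ring
    rw [taylorCoeff, he.iteratedDeriv_eq, iteratedDeriv_const_sub, taylorCoeff,
      iteratedDeriv_neg, iteratedDeriv_const_mul_field]
    · ring
    · omega
  induction n using Nat.strong_induction_on with
  | _ n ih =>
    cases n with
    | zero => simp [taylorCoeff, cqResolvent, resolventSeq_zero, h0]
    | succ n =>
      have h1 := hone n
      rw [taylorCoeff_mul (hs _) (hr _), Finset.sum_range_succ', Nat.sub_zero,
        ← cqWeight_eq_taylorCoeff] at h1
      rw [resolventSeq_succ, ← mul_neg, eq_inv_mul_iff_mul_eq₀ hne, eq_neg_iff_add_eq_zero]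
      have h2 : ∑ j ∈ Finset.range (n + 1), cqWeight α k (j + 1) •
          resolventSeq (cqWeight α k) (cqWeight α k 0 + l)⁻¹ (n - j)
          = ∑ j ∈ Finset.range (n + 1), taylorCoeff (cqSymbol α k) (j + 1)
            * taylorCoeff (cqResolvent α k l) (n + 1 - (j + 1)) := by
        refine Finset.sum_congr rfl fun j hj => ?_
        rw [Nat.add_sub_add_right, ih _ (by omega), smul_eq_mul, cqWeight_eq_taylorCoeff]
      rw [h2]
      linear_combination h1

lemma cqWeight_zero_pos {α : ℝ} {k : ℕ} (hk₁ : 1 ≤ k) :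
    ∃ w : ℝ, 0 < w ∧ cqWeight α k 0 = w := by
  have h1 : bdfGen k 0 = ((∑ l ∈ Finset.Icc 1 k, 1 / (l : ℝ) : ℝ) : ℂ) := by
    simp [bdfGen]
  have h2 : 0 < ∑ l ∈ Finset.Icc 1 k, 1 / (l : ℝ) :=
    Finset.sum_pos (fun l hl => by
      have : 0 < l := (Finset.mem_Icc.1 hl).1
      positivity) ⟨1, by simp [hk₁]⟩
  refine ⟨(∑ l ∈ Finset.Icc 1 k, 1 / (l : ℝ)) ^ α, by positivity, ?_⟩
  rw [Complex.ofReal_cpow h2.le, ← h1]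
  simp [cqWeight]

/-- The scalar discrete resolvent kernel decays like `n ^ (α - 1)`, uniformly in the spectral
parameter `x = (ω 0 + l)⁻¹`, `l ≥ 0`. -/
theorem exists_norm_resolventSeq_scalar_le {α : ℝ} {k : ℕ} (hα₀ : 0 < α) (hα₁ : α < 1)
    (hk₁ : 1 ≤ k) (hk₆ : k ≤ 6) : ∃ C : ℝ, 0 < C ∧ ∀ x : ℝ, 0 ≤ x →
      x * ‖cqWeight α k 0‖ ≤ 1 → ∀ n : ℕ,
      ‖resolventSeq (cqWeight α k) (x : ℂ) n‖ ≤ C * ((n : ℝ) + 1) ^ (α - 1) := by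
  obtain ⟨C, hC, hCn⟩ := exists_norm_taylorCoeff_cqResolvent_le hα₀ hα₁ hk₁ hk₆
  obtain ⟨w, hw, hw0⟩ := cqWeight_zero_pos (α := α) hk₁
  refine ⟨C, hC, fun x hx hx1 n => ?_⟩
  rcases hx.eq_or_lt with rfl | hx
  · rw [Complex.ofReal_zero, resolventSeq_of_zero, norm_zero]; positivity
  · have hl : 0 ≤ x⁻¹ - w := by
      rw [hw0, Complex.norm_real, Real.norm_of_nonneg hw.le, mul_comm, ← le_div_iff₀ hx] at hx1
      simpa using hx1
    have := hCn _ hl n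
    rw [taylorCoeff_cqResolvent_eq hα₀ hα₁ hk₁ hk₆ hl] at this
    convert this using 3
    rw [hw0]; push_cast; simp

lemma eq_sum_resolventSeq {H : Type*} [NormedAddCommGroup H] [InnerProductSpace ℂ H] {w : ℕ → ℂ}
    {b : H →L[ℂ] H} {e r : ℕ → H} {N : ℕ}
    (h : ∀ n < N, e n = b (r n - ∑ j ∈ Finset.range n, w (j + 1) • e (n - 1 - j))) :
    ∀ n < N, e n = ∑ j ∈ Finset.range (n + 1), resolventSeq w b j (r (n - j)) := by
  intro n
  induction n using Nat.strong_induction_on with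
  | _ n ih =>
    intro hn
    rw [h n hn]
    cases n with
    | zero => simp [resolventSeq_zero]
    | succ n =>
      rw [Finset.sum_range_succ' _ (n + 1), resolventSeq_zero, map_sub, Nat.sub_zero,
        sub_eq_neg_add]
      congr 1
      have h1 : ∀ j ∈ Finset.range (n + 1), w (j + 1) • e (n + 1 - 1 - j)
          = ∑ i ∈ Finset.range (n + 1 - j),
            w (j + 1) • resolventSeq w b i (r (n - (j + i))) := by
        intro j hj
        have hj' := Finset.mem_range.1 hj
        rw [ih _ (by omega) (by omega), Finset.smul_sum,
          show n + 1 - 1 - j + 1 = n + 1 - j by omega]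
        refine Finset.sum_congr rfl fun i _ => ?_
        rw [show n + 1 - 1 - j - i = n - (j + i) by omega]
      rw [Finset.sum_congr rfl h1, ← Finset.sum_range_diag_flip (n + 1)
        (fun j i => w (j + 1) • resolventSeq w b i (r (n - (j + i)))), map_sum,
        ← Finset.sum_neg_distrib]
      refine Finset.sum_congr rfl fun m hm => ?_
      rw [resolventSeq_succ, Nat.add_sub_add_right, neg_apply,
        mul_apply_eq_comp, sum_apply]
      congr 2
      refine Finset.sum_congr rfl fun j hj => ?_
      rw [show j + (m - j) = m by have := Finset.mem_range.1 hj; omega]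
      rfl

section Resolvent

open scoped InnerProductSpace

variable {H V : Type*} [NormedAddCommGroup H] [InnerProductSpace ℂ H] [CompleteSpace H]
  [NormedAddCommGroup V] [InnerProductSpace ℂ V] [CompleteSpace V]

lemma resolventSeq_eq_cfc (w : ℕ → ℂ) {b : H →L[ℂ] H} (hb : b.IsPositive) (n : ℕ) :
    resolventSeq w b n = cfc (fun x : ℂ => resolventSeq w x n) b := by
  have hn : IsStarNormal b := hb.isSelfAdjoint.isStarNormal
  have h1 := map_resolventSeq w (Polynomial.aeval (R := ℂ) b) Polynomial.X n
  rw [Polynomial.aeval_X] at h1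
  rw [← h1, ← cfc_polynomial _ b hn]
  congr 1
  funext x
  have h2 := map_resolventSeq w (Polynomial.aeval (R := ℂ) x) Polynomial.X n
  rwa [Polynomial.aeval_X] at h2

lemma norm_resolventSeq_le {w : ℕ → ℂ} {b : H →L[ℂ] H} (hb : b.IsPositive) {n : ℕ} {K : ℝ}
    (hK : 0 ≤ K) (h : ∀ x : ℝ, 0 ≤ x → x ≤ ‖b‖ → ‖resolventSeq w (x : ℂ) n‖ ≤ K) :
    ‖resolventSeq w b n‖ ≤ K := by
  rw [resolventSeq_eq_cfc w hb]
  refine norm_cfc_le hK fun z hz => ?_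
  have hz1 : z = (z.re : ℂ) := hb.isSelfAdjoint.mem_spectrum_eq_re hz
  have hz2 : z.re ∈ spectrum ℝ b := by
    rw [← spectrum.algebraMap_mem_iff ℂ]
    simpa [← hz1] using hz
  have hz3 : 0 ≤ z.re :=
    spectrum_nonneg_of_nonneg ((ContinuousLinearMap.nonneg_iff_isPositive b).2 hb) hz2
  have hz4 : z.re ≤ ‖b‖ := by
    cases subsingleton_or_nontrivial H
    · have : Subsingleton (H →L[ℂ] H) := inferInstance
      simp [spectrum.of_subsingleton] at hz
    · exact (Complex.re_le_norm z).trans (spectrum.norm_le_norm_of_mem hz)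
  rw [hz1]
  exact h _ hz3 hz4

/-- The resolvent `(w₀ + s A)⁻¹`, as a positive bounded operator on `H`. -/
lemma exists_resolvent (ι : V →L[ℂ] H) {A : V →L[ℂ] Antidual V} {β₀ β₁ w₀ s : ℝ}
    (hβ₀ : 0 < β₀) (hA : IsSelfAdjointElliptic A β₀ β₁) (hw₀ : 0 < w₀) (hs : 0 < s) :
    ∃ b : H →L[ℂ] H, b.IsPositive ∧ ‖b‖ * w₀ ≤ 1 ∧ ∀ (u : V) (r : H),
      toAntidual ι ((w₀ : ℂ) • ι u - r) + (s : ℂ) • A u = 0 → ι u = b r := by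
  set ι' := ContinuousLinearMap.adjoint ι
  set T : V →L[ℂ] V := (w₀ : ℂ) • (ι' ∘L ι)
    + (s : ℂ) • InnerProductSpace.continuousLinearMapOfBilin A.flip
  have hT : ∀ u φ : V, ⟪T u, φ⟫_ℂ = w₀ * ⟪ι u, ι φ⟫_ℂ + s * A φ u := fun u φ => by
    simp only [T, ι', add_apply, smul_apply,
      inner_add_left, inner_smul_left, Complex.conj_ofReal, ContinuousLinearMap.comp_apply,
      ContinuousLinearMap.adjoint_inner_left,
      InnerProductSpace.continuousLinearMapOfBilin_apply, ContinuousLinearMap.flip_apply]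
  have hTT : ∀ u : V, ⟪T u, u⟫_ℂ = ((w₀ * ‖ι u‖ ^ 2 + s * (A u u).re : ℝ) : ℂ) := fun u => by
    have h1 : A u u = ((A u u).re : ℂ) := (Complex.conj_eq_iff_re.1 (hA.selfAdjoint u u).symm).symm
    rw [hT, h1, inner_self_eq_norm_sq_to_K]
    push_cast
    simp
  have hAnn : ∀ u : V, 0 ≤ (A u u).re := fun u => le_trans (by positivity) (hA.lower u)
  have hunit : IsUnit T := by
    refine T.isUnit_of_forall_le_norm_inner_map (c := ⟨s * β₀, by positivity⟩)
      (by exact_mod_cast mul_pos hs hβ₀) fun u => ?_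
    have h1 := mul_le_mul_of_nonneg_left (hA.lower u) hs.le
    have h2 : 0 ≤ w₀ * ‖ι u‖ ^ 2 := by positivity
    rw [hTT, Complex.norm_real]
    refine le_trans ?_ (le_abs_self _)
    change ‖u‖ ^ 2 * (s * β₀) ≤ _
    linarith
  obtain ⟨S, hS⟩ := hunit
  have hST : ∀ u, (↑S⁻¹ : V →L[ℂ] V) (T u) = u := fun u => by
    rw [← hS, ← mul_apply_eq_comp, Units.inv_mul, one_apply_eq_self]
  have hTS : ∀ u, T ((↑S⁻¹ : V →L[ℂ] V) u) = u := fun u => by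
    rw [← hS, ← mul_apply_eq_comp, Units.mul_inv, one_apply_eq_self]
  set b : H →L[ℂ] H := ι ∘L (↑S⁻¹ : V →L[ℂ] V) ∘L ι'
  have hb : ∀ h : H, ⟪h, b h⟫_ℂ
      = ⟪T ((↑S⁻¹ : V →L[ℂ] V) (ι' h)), (↑S⁻¹ : V →L[ℂ] V) (ι' h)⟫_ℂ := fun h => by
    rw [hTS, ContinuousLinearMap.adjoint_inner_left]
    rfl
  refine ⟨b, ?_, ?_, ?_⟩
  · rw [ContinuousLinearMap.isPositive_iff_complex]
    intro h
    rw [← inner_conj_symm, hb, hTT, Complex.conj_ofReal]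
    refine ⟨rfl, ?_⟩
    have := hAnn ((↑S⁻¹ : V →L[ℂ] V) (ι' h))
    simp only [RCLike.re_to_complex, Complex.ofReal_re]
    positivity
  · rw [← le_div_iff₀ hw₀]
    refine b.opNorm_le_bound (by positivity) fun h => ?_
    have h1 : w₀ * ‖b h‖ ^ 2 ≤ ‖h‖ * ‖b h‖ := by
      have h2 := (Complex.re_le_norm ⟪h, b h⟫_ℂ).trans (norm_inner_le_norm h (b h))
      rw [hb, hTT, Complex.ofReal_re] at h2
      have h3 := mul_nonneg hs.le (hAnn ((↑S⁻¹ : V →L[ℂ] V) (ι' h)))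
      have h4 : ι ((↑S⁻¹ : V →L[ℂ] V) (ι' h)) = b h := rfl
      rw [h4] at h2
      linarith
    rw [div_mul_eq_mul_div, one_mul, le_div_iff₀ hw₀]
    rcases (norm_nonneg (b h)).eq_or_lt with h0 | h0
    · rw [← h0]; simp
    · nlinarith
  · intro u r h
    have h1 : T u = ι' r := by
      refine ext_inner_right ℂ fun φ => ?_
      have h2 := congrArg (fun f : Antidual V => conj (f φ)) h
      simp only [toAntidual, add_apply, ContinuousLinearMap.comp_apply,
        innerSLFlip_apply_apply, smul_apply, smul_eq_mul, map_add, map_mul,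
        Complex.conj_ofReal, ← hA.selfAdjoint φ u, zero_apply, map_zero,
        inner_conj_symm, inner_sub_left, inner_smul_left] at h2
      rw [hT, ContinuousLinearMap.adjoint_inner_left]
      linear_combination h2
    change ι u = ι ((↑S⁻¹ : V →L[ℂ] V) (ι' r))
    rw [← h1, hST]

end Resolvent

section Sums

variable {α : ℝ}

lemma rpow_sub_one_le_sub {x : ℝ} (hα₀ : 0 < α) (hα₁ : α < 1) (hx : 0 ≤ x) :
    (x + 1) ^ (α - 1) ≤ ((x + 1) ^ α - x ^ α) / α := by
  have hx1 : 0 < x + 1 := by linarith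
  have h1 := rpow_one_add_le_one_add_mul_self (s := -(x + 1)⁻¹) (p := α)
    (by rw [neg_le_neg_iff]; exact inv_le_one_of_one_le₀ (by linarith)) hα₀.le hα₁.le
  have h2 : 1 + -(x + 1)⁻¹ = x / (x + 1) := by field_simp; ring
  rw [h2, Real.div_rpow hx hx1.le, div_le_iff₀ (by positivity)] at h1
  rw [le_div_iff₀ hα₀, Real.rpow_sub_one hx1.ne']
  have h3 : (1 + α * -(x + 1)⁻¹) * (x + 1) ^ α = (x + 1) ^ α - (x + 1) ^ α / (x + 1) * α := by
    ring
  linarith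

lemma rpow_neg_one_sub_le_sub {x : ℝ} (hα₀ : 0 < α) (hα₁ : α < 1) (hx : 0 < x) :
    (x + 1) ^ (-1 - α) ≤ (x ^ (-α) - (x + 1) ^ (-α)) / α := by
  have hx1 : 0 < x + 1 := by linarith
  have h1 := rpow_sub_one_le_sub hα₀ hα₁ hx.le
  rw [le_div_iff₀ hα₀] at h1 ⊢
  have hle : x ^ α ≤ (x + 1) ^ α := by gcongr; linarith
  have hp : 0 < x ^ α := by positivity
  have hq : 0 < (x + 1) ^ α := by positivity
  have e : (x + 1) ^ (-1 - α) = (x + 1) ^ (α - 1) / ((x + 1) ^ α * (x + 1) ^ α) := by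
    rw [← Real.rpow_add hx1, ← Real.rpow_sub hx1]; congr 1; ring
  rw [e, Real.rpow_neg hx.le, Real.rpow_neg hx1.le, inv_sub_inv hp.ne' hq.ne', div_mul_eq_mul_div]
  gcongr

lemma sum_rpow_sub_one_le (hα₀ : 0 < α) (hα₁ : α < 1) (n : ℕ) :
    ∑ j ∈ Finset.range n, ((j : ℝ) + 1) ^ (α - 1) ≤ (n : ℝ) ^ α / α := by
  calc _ ≤ ∑ j ∈ Finset.range n, ((((j + 1 : ℕ) : ℝ) ^ α) / α - ((j : ℝ) ^ α) / α) :=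
        Finset.sum_le_sum fun j _ => by
          rw [← sub_div]
          exact_mod_cast rpow_sub_one_le_sub hα₀ hα₁ (Nat.cast_nonneg j)
    _ = _ := by
        rw [Finset.sum_range_sub (fun j : ℕ => ((j : ℝ) ^ α) / α)]
        simp [Real.zero_rpow hα₀.ne']

lemma sum_rpow_neg_one_sub_le (hα₀ : 0 < α) (hα₁ : α < 1) {a : ℝ} (ha : 0 < a) (n : ℕ) :
    ∑ j ∈ Finset.range n, ((j : ℝ) + 1 + a) ^ (-1 - α) ≤ a ^ (-α) / α := by
  calc _ ≤ ∑ j ∈ Finset.range n, (((j : ℝ) + a) ^ (-α) / α - (((j + 1 : ℕ) : ℝ) + a) ^ (-α) / α) :=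
        Finset.sum_le_sum fun j _ => by
          rw [← sub_div, Nat.cast_succ, add_right_comm]
          exact rpow_neg_one_sub_le_sub hα₀ hα₁ (by positivity)
    _ ≤ _ := by
        rw [Finset.sum_range_sub' (fun j : ℕ => (((j : ℝ) + a) ^ (-α)) / α)]
        have : 0 ≤ ((n : ℝ) + a) ^ (-α) / α := by positivity
        simpa using this

lemma sum_kernel_mul_weight_le (hα₀ : 0 < α) (hα₁ : α < 1) {a : ℝ} (ha : 0 < a) (n : ℕ) :
    ∑ j ∈ Finset.range (n + 1), ((j : ℝ) + 1) ^ (α - 1) * (((n - j : ℕ) : ℝ) + 1 + a) ^ (-1 - α)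
      ≤ 4 / α * ((n : ℝ) + 1) ^ (α - 1) * a ^ (-α) := by
  have hn : (0 : ℝ) < (n : ℝ) + 1 := by positivity
  have hterm : ∀ j ∈ Finset.range (n + 1),
      ((j : ℝ) + 1) ^ (α - 1) * (((n - j : ℕ) : ℝ) + 1 + a) ^ (-1 - α)
      ≤ 2 * ((n : ℝ) + 1) ^ (α - 1) * (((n - j : ℕ) : ℝ) + 1 + a) ^ (-1 - α)
        + 2 / ((n : ℝ) + 1) * a ^ (-α) * ((j : ℝ) + 1) ^ (α - 1) := by
    intro j hj
    have hc : ((n - j : ℕ) : ℝ) = n - j := Nat.cast_sub (Nat.lt_succ_iff.1 (Finset.mem_range.1 hj))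
    have hpos : 0 < ((n - j : ℕ) : ℝ) + 1 + a := by positivity
    rcases le_total (((n : ℝ) + 1) / 2) ((j : ℝ) + 1) with h | h
    · have h1 : ((j : ℝ) + 1) ^ (α - 1) ≤ 2 * ((n : ℝ) + 1) ^ (α - 1) := by
        calc _ ≤ (((n : ℝ) + 1) / 2) ^ (α - 1) :=
              Real.rpow_le_rpow_of_nonpos (by positivity) h (by linarith)
          _ = 2 ^ (1 - α) * ((n : ℝ) + 1) ^ (α - 1) := by
              rw [Real.div_rpow hn.le (by norm_num), show 1 - α = -(α - 1) by ring,
                Real.rpow_neg (by norm_num) (α - 1)]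
              ring
          _ ≤ 2 ^ (1 : ℝ) * ((n : ℝ) + 1) ^ (α - 1) := by
              gcongr
              · norm_num
              · linarith
          _ = _ := by rw [Real.rpow_one]
      have h2 : 0 ≤ 2 / ((n : ℝ) + 1) * a ^ (-α) * ((j : ℝ) + 1) ^ (α - 1) := by positivity
      have := mul_le_mul_of_nonneg_right h1 (Real.rpow_nonneg hpos.le (-1 - α))
      linarith
    · have h1 : (((n - j : ℕ) : ℝ) + 1 + a) ^ (-1 - α) ≤ 2 / ((n : ℝ) + 1) * a ^ (-α) := by
        rw [show -1 - α = -1 + -α by ring, Real.rpow_add hpos, Real.rpow_neg_one]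
        refine mul_le_mul ?_ ?_ (by positivity) (by positivity)
        · rw [inv_le_comm₀ hpos (by positivity), inv_div, hc]
          linarith
        · refine Real.rpow_le_rpow_of_nonpos ha ?_ (by linarith)
          have : (0 : ℝ) ≤ ((n - j : ℕ) : ℝ) := Nat.cast_nonneg _
          linarith
      have h2 : 0 ≤ 2 * ((n : ℝ) + 1) ^ (α - 1) * (((n - j : ℕ) : ℝ) + 1 + a) ^ (-1 - α) := by
        positivity
      have := mul_le_mul_of_nonneg_left h1
        (Real.rpow_nonneg (by positivity : (0 : ℝ) ≤ (j : ℝ) + 1) (α - 1))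
      linarith
  refine (Finset.sum_le_sum hterm).trans ?_
  rw [Finset.sum_add_distrib, ← Finset.mul_sum, ← Finset.mul_sum]
  have hs1 : ∑ j ∈ Finset.range (n + 1), (((n - j : ℕ) : ℝ) + 1 + a) ^ (-1 - α)
      ≤ a ^ (-α) / α := by
    have := Finset.sum_range_reflect (fun j : ℕ => ((j : ℝ) + 1 + a) ^ (-1 - α)) (n + 1)
    simp only [Nat.add_sub_cancel] at this
    rw [this]
    exact sum_rpow_neg_one_sub_le hα₀ hα₁ ha _
  have hs2 := sum_rpow_sub_one_le hα₀ hα₁ (n + 1)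
  calc _ ≤ 2 * ((n : ℝ) + 1) ^ (α - 1) * (a ^ (-α) / α)
        + 2 / ((n : ℝ) + 1) * a ^ (-α) * (((n + 1 : ℕ) : ℝ) ^ α / α) := by gcongr
    _ = _ := by
      rw [Real.rpow_sub_one hn.ne']
      push_cast
      field_simp
      ring

lemma sum_rpow_neg_mul_rpow_le (hα₀ : 0 < α) (hα₁ : α < 1) {N : ℕ} (hN : 1 ≤ N) :
    ∑ i ∈ Finset.range N, ((i : ℝ) + 1) ^ (-α) * ((N - i : ℕ) : ℝ) ^ (α - 1)
      ≤ 2 / α + 2 / (1 - α) := by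
  have hN0 : (0 : ℝ) < N := by exact_mod_cast hN
  have hhalf : ∀ x : ℝ, (N : ℝ) / 2 ≤ x → ∀ r : ℝ, 0 ≤ r → r ≤ 1 →
      x ^ (-r) ≤ 2 * (N : ℝ) ^ (-r) := fun x hx r hr0 hr1 => by
    calc x ^ (-r) ≤ ((N : ℝ) / 2) ^ (-r) :=
          Real.rpow_le_rpow_of_nonpos (by positivity) hx (by linarith)
      _ = 2 ^ r * (N : ℝ) ^ (-r) := by
          rw [Real.div_rpow hN0.le (by norm_num), Real.rpow_neg (x := 2) (by norm_num),
            div_inv_eq_mul, mul_comm]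
      _ ≤ 2 ^ (1 : ℝ) * (N : ℝ) ^ (-r) := by
          gcongr
          norm_num
      _ = _ := by rw [Real.rpow_one]
  have hterm : ∀ i ∈ Finset.range N, ((i : ℝ) + 1) ^ (-α) * ((N - i : ℕ) : ℝ) ^ (α - 1)
      ≤ 2 * (N : ℝ) ^ (-α) * ((N - i : ℕ) : ℝ) ^ (α - 1)
        + 2 * (N : ℝ) ^ (-(1 - α)) * ((i : ℝ) + 1) ^ (-α) := by
    intro i hi
    have hc : ((N - i : ℕ) : ℝ) = N - i := Nat.cast_sub (Finset.mem_range.1 hi).le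
    have hp : 0 ≤ ((N - i : ℕ) : ℝ) ^ (α - 1) := by positivity
    have hq : 0 ≤ ((i : ℝ) + 1) ^ (-α) := by positivity
    rcases le_total ((N : ℝ) / 2) ((i : ℝ) + 1) with h | h
    · have h1 := mul_le_mul_of_nonneg_right (hhalf _ h α hα₀.le hα₁.le) hp
      have h2 : 0 ≤ 2 * (N : ℝ) ^ (-(1 - α)) * ((i : ℝ) + 1) ^ (-α) := by positivity
      linarith
    · have h1 := mul_le_mul_of_nonneg_left
        (hhalf ((N - i : ℕ) : ℝ) (by rw [hc]; linarith) (1 - α) (by linarith) (by linarith)) hq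
      rw [neg_sub] at h1 ⊢
      have h2 : 0 ≤ 2 * (N : ℝ) ^ (-α) * ((N - i : ℕ) : ℝ) ^ (α - 1) := by positivity
      linarith
  refine (Finset.sum_le_sum hterm).trans ?_
  rw [Finset.sum_add_distrib, ← Finset.mul_sum, ← Finset.mul_sum]
  have hs1 : ∑ i ∈ Finset.range N, ((N - i : ℕ) : ℝ) ^ (α - 1) ≤ (N : ℝ) ^ α / α := by
    refine le_trans (le_of_eq ?_) (sum_rpow_sub_one_le hα₀ hα₁ N)
    rw [← Finset.sum_range_reflect]
    refine Finset.sum_congr rfl fun i hi => ?_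
    have := Finset.mem_range.1 hi
    rw [show N - (N - 1 - i) = i + 1 by omega, Nat.cast_succ]
  have hs2 := sum_rpow_sub_one_le (α := 1 - α) (by linarith) (by linarith) N
  rw [show 1 - α - 1 = -α by ring] at hs2
  calc _ ≤ 2 * (N : ℝ) ^ (-α) * ((N : ℝ) ^ α / α)
        + 2 * (N : ℝ) ^ (-(1 - α)) * ((N : ℝ) ^ (1 - α) / (1 - α)) := by gcongr
    _ = _ := by
      have h1 : (N : ℝ) ^ α ≠ 0 := by positivity
      have h2 : (N : ℝ) ^ (1 - α) ≠ 0 := by positivity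
      rw [Real.rpow_neg hN0.le, Real.rpow_neg hN0.le]
      field_simp

end Sums

section Sweep

variable {H V : Type*} [NormedAddCommGroup H] [InnerProductSpace ℂ H]
  [NormedAddCommGroup V] [InnerProductSpace ℂ V] {α : ℝ} {k N : ℕ}

lemma summable_cqWeight (hα₀ : 0 < α) (hα₁ : α < 1) (hk₁ : 1 ≤ k) (hk₆ : k ≤ 6) :
    Summable (cqWeight α k) := by
  obtain ⟨C, hC, hCn⟩ := exists_norm_cqWeight_le hα₀ hα₁ hk₁ hk₆
  refine Summable.of_norm_bounded (g := fun n : ℕ => C * ((n : ℝ) + 1) ^ (-1 - α)) ?_ hCn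
  refine Summable.mul_left C ?_
  have h := (summable_nat_add_iff 1).2 (Real.summable_nat_rpow.2 (by linarith : -1 - α < -1))
  exact_mod_cast h

lemma summable_cqWeight_smul {w : ℕ → ℂ} (hw : Summable w) {U : ℤ → H} {v : H}
    (hU : ∀ n : ℤ, n ≤ -(N : ℤ) → U n = v) (n : ℤ) :
    Summable fun j : ℕ => w j • U (n - j) := by
  have h1 : Summable fun j : ℕ => w j • (U (n - j) - v) := by
    refine summable_of_ne_finset_zero (s := Finset.range (n + N).toNat) fun j hj => ?_
    rw [hU, sub_self, smul_zero]
    rw [Finset.mem_range, not_lt] at hj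
    omega
  refine (h1.add (hw.smul_const v)).congr fun j => ?_
  rw [← smul_add, sub_add_cancel]

lemma tsum_cqWeight_smul {w : ℕ → ℂ} {E : ℤ → H}
    (hE : ∀ n : ℤ, n ≤ -(N : ℤ) → E n = 0) (m : ℕ) :
    ∑' j : ℕ, w j • E (((m + 1 : ℕ) : ℤ) - j) = w 0 • E ((m : ℤ) + 1)
      - (-(∑ i ∈ Finset.range N, w (m + 1 + i) • E (-(i : ℤ)))
        - ∑ j ∈ Finset.range m, w (j + 1) • E (((m - 1 - j : ℕ) : ℤ) + 1)) := by
  rw [tsum_eq_sum (s := Finset.range (m + 1 + N)), Finset.sum_range_add, Finset.sum_range_succ']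
  · have h1 : ∑ j ∈ Finset.range m, w (j + 1) • E (((m + 1 : ℕ) : ℤ) - (j + 1 : ℕ))
        = ∑ j ∈ Finset.range m, w (j + 1) • E (((m - 1 - j : ℕ) : ℤ) + 1) := by
      refine Finset.sum_congr rfl fun j hj => ?_
      have := Finset.mem_range.1 hj
      congr 2
      omega
    have h2 : ∑ i ∈ Finset.range N, w (m + 1 + i) • E (((m + 1 : ℕ) : ℤ) - (m + 1 + i : ℕ))
        = ∑ i ∈ Finset.range N, w (m + 1 + i) • E (-(i : ℤ)) := by
      refine Finset.sum_congr rfl fun i _ => ?_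
      congr 2
      omega
    rw [h1, h2]
    simp only [Nat.cast_add, Nat.cast_one, Nat.cast_zero, sub_zero]
    abel
  · intro j hj
    rw [hE, smul_zero]
    rw [Finset.mem_range, not_lt] at hj
    omega

lemma toAntidual_sub (ι : V →L[ℂ] H) (g h : H) :
    toAntidual ι (g - h) = toAntidual ι g - toAntidual ι h := by
  simp [toAntidual]

lemma toAntidual_smul (ι : V →L[ℂ] H) (c : ℂ) (h : H) :
    toAntidual ι (c • h) = c • toAntidual ι h := by
  simp [toAntidual]

variable [CompleteSpace H] [CompleteSpace V]

/-- One sweep: the error is controlled by the errors of the two iterates which enter the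
perturbed history. -/
lemma norm_sub_iterate_le (hα₀ : 0 < α) (hα₁ : α < 1) (hk₁ : 1 ≤ k) (hk₆ : k ≤ 6) {C₁ C₂ : ℝ}
    (hC₁ : 0 < C₁) (hC₂ : 0 < C₂)
    (hw : ∀ n : ℕ, ‖cqWeight α k n‖ ≤ C₁ * ((n : ℝ) + 1) ^ (-1 - α))
    (hr : ∀ x : ℝ, 0 ≤ x → x * ‖cqWeight α k 0‖ ≤ 1 → ∀ n : ℕ,
      ‖resolventSeq (cqWeight α k) (x : ℂ) n‖ ≤ C₂ * ((n : ℝ) + 1) ^ (α - 1))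
    {T β₀ β₁ κ : ℝ} (hT : 0 < T) (hβ₀ : 0 < β₀) (hκ : 0 < κ) {ι : V →L[ℂ] H}
    {A : V →L[ℂ] Antidual V} (hA : IsSelfAdjointElliptic A β₀ β₁) {v : H}
    {f : ℝ → Antidual V} {U Wp W : ℤ → H} (hU : IsCQSolution ι A α k T N v f U)
    (hW : IsIterate ι A α k T N v f κ Wp W) {n : ℕ} (hn : n < N) :
    ‖U ((n : ℤ) + 1) - W ((n : ℤ) + 1)‖ ≤ C₁ * C₂ * (4 / α) * κ * ((n : ℝ) + 1) ^ (α - 1) *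
      ∑ i ∈ Finset.range N, ((i : ℝ) + 1) ^ (-α) *
        (‖U ((N : ℤ) - i) - W ((N : ℤ) - i)‖ + ‖U ((N : ℤ) - i) - Wp ((N : ℤ) - i)‖) := by
  set w := cqWeight α k with hwdef
  set E : ℤ → H := fun n => U n - W n with hEdef
  have hUfar : ∀ n : ℤ, n ≤ -(N : ℤ) → U n = v := fun n hn => hU.history n (by omega)
  have hE : ∀ n : ℤ, n ≤ -(N : ℤ) → E n = 0 := fun n hn => by
    simp only [hEdef, hUfar n hn, hW.farHistory n hn, sub_self]
  set d : ℕ → ℝ := fun i => ‖U ((N : ℤ) - i) - W ((N : ℤ) - i)‖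
    + ‖U ((N : ℤ) - i) - Wp ((N : ℤ) - i)‖
  have hEd : ∀ i ∈ Finset.range N, ‖E (-(i : ℤ))‖ ≤ κ * d i := fun i hi => by
    have h1 : E (-(i : ℤ)) = (κ : ℂ) • ((U ((N : ℤ) - i) - W ((N : ℤ) - i))
        - (U ((N : ℤ) - i) - Wp ((N : ℤ) - i))) := by
      simp only [hEdef, hU.history (-(i : ℤ)) (by omega), hW.history i (Finset.mem_range.1 hi)]
      rw [sub_sub_sub_cancel_left, ← sub_sub, sub_self, zero_sub, ← smul_neg, neg_sub]
    rw [h1, norm_smul, Complex.norm_real, Real.norm_of_nonneg hκ.le]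
    gcongr
    exact norm_sub_le _ _
  obtain ⟨w₀, hw₀, hw0⟩ := cqWeight_zero_pos (α := α) (k := k) hk₁
  have hN : (0 : ℝ) < N := by exact_mod_cast (Nat.zero_le n).trans_lt hn
  have hτ : 0 < (T / N) ^ α := by positivity
  obtain ⟨b, hb, hbn, hbs⟩ := exists_resolvent ι hβ₀ hA hw₀ hτ
  set r : ℕ → H := fun m => -(∑ i ∈ Finset.range N, w (m + 1 + i) • E (-(i : ℤ))) with hrdef
  have hstep : ∀ m < N, E ((m : ℤ) + 1) = b (r m
      - ∑ j ∈ Finset.range m, w (j + 1) • E (((m - 1 - j : ℕ) : ℤ) + 1)) := by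
    intro m hm
    obtain ⟨u₁, hu₁, he₁⟩ := hU.step (m + 1) (by omega) (by omega)
    obtain ⟨u₂, hu₂, he₂⟩ := hW.step (m + 1) (by omega) (by omega)
    have hu : ι (u₁ - u₂) = E ((m : ℤ) + 1) := by
      rw [map_sub, hu₁, hu₂, add_sub_add_right_eq_sub]
      push_cast
      rfl
    rw [← hu]
    refine hbs _ _ ?_
    rw [hu, ← hw0, ← hwdef, hrdef, ← tsum_cqWeight_smul hE]
    have hs := summable_cqWeight hα₀ hα₁ hk₁ hk₆
    have h1 : ∑' j : ℕ, w j • E (((m + 1 : ℕ) : ℤ) - j)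
        = (((T / N) ^ α : ℝ) : ℂ) • (cqDeriv α k (T / N) U (m + 1 : ℕ)
          - cqDeriv α k (T / N) W (m + 1 : ℕ)) := by
      rw [cqDeriv, cqDeriv, ← smul_sub, smul_smul, ← Complex.ofReal_mul,
        mul_one_div_cancel hτ.ne', Complex.ofReal_one, one_smul,
        ← (summable_cqWeight_smul hs hUfar _).tsum_sub
          (summable_cqWeight_smul hs hW.farHistory _)]
      simp only [hEdef, smul_sub, hwdef]
    rw [h1, toAntidual_smul, toAntidual_sub, map_sub]
    refine (smul_add _ (_ : Antidual V) _).symm.trans ?_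
    have h2 : toAntidual ι (cqDeriv α k (T / N) U (m + 1 : ℕ))
        - toAntidual ι (cqDeriv α k (T / N) W (m + 1 : ℕ)) + (A u₁ - A u₂) = 0 := by
      rw [sub_add_sub_comm, he₁, he₂, sub_self]
    rw [h2, smul_zero]
  have hsol := eq_sum_resolventSeq (e := fun m : ℕ => E ((m : ℤ) + 1)) hstep n hn
  have hG : ∀ j : ℕ, ‖resolventSeq w b j‖ ≤ C₂ * ((j : ℝ) + 1) ^ (α - 1) := fun j =>
    norm_resolventSeq_le hb (by positivity) fun x hx hxb => hr x hx (by
      rw [hwdef, hw0, Complex.norm_real, Real.norm_of_nonneg hw₀.le]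
      exact (mul_le_mul_of_nonneg_right hxb hw₀.le).trans hbn) j
  have hrn : ∀ m : ℕ, ‖r m‖
      ≤ ∑ i ∈ Finset.range N, C₁ * ((m : ℝ) + 1 + (i + 1)) ^ (-1 - α) * (κ * d i) := fun m => by
    rw [hrdef, norm_neg]
    refine (norm_sum_le _ _).trans (Finset.sum_le_sum fun i hi => ?_)
    rw [norm_smul]
    have h1 := hw (m + 1 + i)
    push_cast at h1
    rw [add_assoc ((m : ℝ) + 1)] at h1
    exact mul_le_mul h1 (hEd i hi) (norm_nonneg _) (by positivity)
  calc ‖U ((n : ℤ) + 1) - W ((n : ℤ) + 1)‖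
      = ‖∑ j ∈ Finset.range (n + 1), resolventSeq w b j (r (n - j))‖ := congrArg norm hsol
    _ ≤ ∑ j ∈ Finset.range (n + 1), C₂ * ((j : ℝ) + 1) ^ (α - 1) *
        ∑ i ∈ Finset.range N,
          C₁ * (((n - j : ℕ) : ℝ) + 1 + (i + 1)) ^ (-1 - α) * (κ * d i) := by
        refine (norm_sum_le _ _).trans (Finset.sum_le_sum fun j _ => ?_)
        refine ((resolventSeq w b j).le_opNorm _).trans ?_
        exact mul_le_mul (hG j) (hrn _) (norm_nonneg _) (by positivity)
    _ = C₁ * C₂ * κ * ∑ i ∈ Finset.range N, d i * ∑ j ∈ Finset.range (n + 1),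
        ((j : ℝ) + 1) ^ (α - 1) * (((n - j : ℕ) : ℝ) + 1 + (i + 1)) ^ (-1 - α) := by
        simp only [Finset.mul_sum]
        rw [Finset.sum_comm]
        refine Finset.sum_congr rfl fun i _ => Finset.sum_congr rfl fun j _ => ?_
        ring
    _ ≤ C₁ * C₂ * κ * ∑ i ∈ Finset.range N,
        d i * (4 / α * ((n : ℝ) + 1) ^ (α - 1) * ((i : ℝ) + 1) ^ (-α)) := by
        gcongr with i _
        exact sum_kernel_mul_weight_le hα₀ hα₁ (by positivity) n
    _ = _ := by
        simp only [Finset.mul_sum]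
        refine Finset.sum_congr rfl fun i _ => ?_
        ring

end Sweep

/-- Absorption argument behind the geometric convergence of the sweeps. -/
lemma le_geometric_of_absorb {S : ℕ → ℝ} {θ : ℝ} (hθ₀ : 0 ≤ θ) (hθ₁ : θ < 1)
    (h : ∀ m, S (m + 1) ≤ θ * (S (m + 1) + S m)) (m : ℕ) : S m ≤ (θ / (1 - θ)) ^ m * S 0 := by
  have h1 : 0 < 1 - θ := by linarith
  induction m with
  | zero => simp
  | succ m ih =>
    have h2 : S (m + 1) ≤ θ / (1 - θ) * S m := by
      rw [div_mul_eq_mul_div, le_div_iff₀ h1]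
      linarith [h m]
    calc _ ≤ θ / (1 - θ) * S m := h2
      _ ≤ θ / (1 - θ) * ((θ / (1 - θ)) ^ m * S 0) := by gcongr
      _ = _ := by ring

end CQBDF

theorem corollary3 (α : ℝ) (hα₀ : 0 < α) (hα₁ : α < 1) (k : ℕ) (hk₁ : 1 ≤ k) (hk₆ : k ≤ 6)
    (T : ℝ) (hT : 0 < T) (β₀ : ℝ) (hβ₀ : 0 < β₀) :
    ∃ C c : ℝ, 0 < C ∧ 0 < c ∧
      ∀ (H : Type*) [NormedAddCommGroup H] [InnerProductSpace ℂ H] [CompleteSpace H]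
        (V : Type*) [NormedAddCommGroup V] [InnerProductSpace ℂ V] [CompleteSpace V]
        (ι : V →L[ℂ] H) (A : V →L[ℂ] CQBDF.Antidual V) (β₁ : ℝ)
        (v : H) (f : ℝ → CQBDF.Antidual V) (N : ℕ) (κ : ℝ)
        (U : ℤ → H) (W : ℕ → ℤ → H),
        CQBDF.IsGelfandEmbedding ι →
        CQBDF.IsSelfAdjointElliptic A β₀ β₁ →
        ContDiffOn ℝ ((k - 2 : ℕ) : ℕ∞) f (Set.Icc 0 T) →
        2 ≤ N →
        0 < κ → κ < 1 / (2 * c * Real.log N) →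
        CQBDF.IsCQSolution ι A α k T N v f U →
        (∀ m : ℕ, CQBDF.IsIterate ι A α k T N v f κ (W m) (W (m + 1))) →
        0 < CQBDF.convFactor c κ N ∧ CQBDF.convFactor c κ N < 1 ∧
        ∀ m : ℕ, 1 ≤ m → ∀ n : ℕ, 1 ≤ n → n ≤ N →
          ‖U n - W m n‖ ≤
            C * ((n : ℝ) * (T / N)) ^ (α - 1) * CQBDF.convFactor c κ N ^ m *
              ((T / N) * ∑ j ∈ Finset.Icc 1 N,
                ((j : ℝ) * (T / N)) ^ (-α) *
                  ‖U ((N : ℤ) - j + 1) - W 0 ((N : ℤ) - j + 1)‖) := by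
  obtain ⟨C₁, hC₁, hw⟩ := CQBDF.exists_norm_cqWeight_le hα₀ hα₁ hk₁ hk₆
  obtain ⟨C₂, hC₂, hr⟩ := CQBDF.exists_norm_resolventSeq_scalar_le hα₀ hα₁ hk₁ hk₆
  set K : ℝ := C₁ * C₂ * (4 / α) with hKdef
  set B : ℝ := 2 / α + 2 / (1 - α) with hBdef
  have hα₁' : 0 < 1 - α := by linarith
  have hK : 0 < K := by positivity
  have hB : 0 < B := by positivity
  have hlog2 : 0 < Real.log 2 := Real.log_pos (by norm_num)
  refine ⟨B⁻¹, K * B / Real.log 2, by positivity, by positivity, ?_⟩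
  intro H _ _ _ V _ _ _ ι A β₁ v f N κ U W _ hA _ hN hκ hκc hU hW
  set c : ℝ := K * B / Real.log 2 with hcdef
  have hc : 0 < c := by positivity
  have hN0 : (0 : ℝ) < N := by positivity
  have hL2 : Real.log 2 ≤ Real.log N := Real.log_le_log (by norm_num) (by exact_mod_cast hN)
  have hL : 0 < Real.log N := hlog2.trans_le hL2
  set θ : ℝ := c * κ * Real.log N with hθdef
  have hθ₀ : 0 < θ := by positivity
  have hθ₁ : θ < 1 / 2 := by
    rw [lt_div_iff₀ (by positivity)] at hκc
    rw [hθdef]; linarith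
  have h1θ : 0 < 1 - θ := by linarith
  have hγ : CQBDF.convFactor c κ N = θ / (1 - θ) := rfl
  have hKB : κ * K * B ≤ θ := by
    have : K * B = c * Real.log 2 := by rw [hcdef]; field_simp
    calc κ * K * B = c * κ * Real.log 2 := by rw [mul_assoc, this]; ring
      _ ≤ θ := by rw [hθdef]; gcongr
  refine ⟨by rw [hγ]; positivity, by rw [hγ, div_lt_one h1θ]; linarith, ?_⟩
  set S : ℕ → ℝ := fun m => ∑ i ∈ Finset.range N,
    ((i : ℝ) + 1) ^ (-α) * ‖U ((N : ℤ) - i) - W m ((N : ℤ) - i)‖ with hSdef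
  have hS0 : ∀ m, 0 ≤ S m := fun m => Finset.sum_nonneg fun i _ => by positivity
  have hsweep : ∀ m n : ℕ, n < N → ‖U ((n : ℤ) + 1) - W (m + 1) ((n : ℤ) + 1)‖
      ≤ K * κ * ((n : ℝ) + 1) ^ (α - 1) * (S (m + 1) + S m) := fun m n hn => by
    have h := CQBDF.norm_sub_iterate_le hα₀ hα₁ hk₁ hk₆ hC₁ hC₂ hw hr hT hβ₀ hκ hA hU (hW m) hn
    simpa only [hSdef, mul_add, Finset.sum_add_distrib] using h
  have habs : ∀ m, S (m + 1) ≤ θ * (S (m + 1) + S m) := fun m => by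
    have hpos : 0 ≤ S (m + 1) + S m := add_nonneg (hS0 _) (hS0 _)
    calc S (m + 1) ≤ ∑ i ∈ Finset.range N, ((i : ℝ) + 1) ^ (-α) *
          (K * κ * ((N - i : ℕ) : ℝ) ^ (α - 1) * (S (m + 1) + S m)) := by
          refine Finset.sum_le_sum fun i hi => ?_
          have hi' := Finset.mem_range.1 hi
          have h := hsweep m (N - 1 - i) (by omega)
          rw [show ((N - 1 - i : ℕ) : ℤ) + 1 = (N : ℤ) - i by omega,
            show ((N - 1 - i : ℕ) : ℝ) + 1 = ((N - i : ℕ) : ℝ) by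
              rw [← Nat.cast_succ]; congr 1; omega] at h
          gcongr
      _ = K * κ * (S (m + 1) + S m) * ∑ i ∈ Finset.range N,
          ((i : ℝ) + 1) ^ (-α) * ((N - i : ℕ) : ℝ) ^ (α - 1) := by
          rw [Finset.mul_sum]
          exact Finset.sum_congr rfl fun i _ => by ring
      _ ≤ K * κ * (S (m + 1) + S m) * B := by
          gcongr
          exact CQBDF.sum_rpow_neg_mul_rpow_le hα₀ hα₁ (by omega)
      _ = κ * K * B * (S (m + 1) + S m) := by ring
      _ ≤ _ := by gcongr
  have hgeo := CQBDF.le_geometric_of_absorb hθ₀.le (by linarith) habs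
  intro m hm n hn hnN
  obtain ⟨m, rfl⟩ := Nat.exists_eq_add_of_le' hm
  obtain ⟨n, rfl⟩ := Nat.exists_eq_add_of_le' hn
  have ht : 0 < T / N := by positivity
  have hscale : T / N * ∑ j ∈ Finset.Icc 1 N, ((j : ℝ) * (T / N)) ^ (-α) *
      ‖U ((N : ℤ) - j + 1) - W 0 ((N : ℤ) - j + 1)‖ = T / N * (T / N) ^ (-α) * S 0 := by
    rw [mul_assoc]
    congr 1
    rw [hSdef, Finset.mul_sum, ← Finset.Ico_add_one_right_eq_Icc,
      Finset.sum_Ico_eq_sum_range, Nat.add_sub_cancel]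
    refine Finset.sum_congr rfl fun i _ => ?_
    rw [show (N : ℤ) - (1 + i : ℕ) + 1 = (N : ℤ) - i by omega,
      Real.mul_rpow (by positivity) ht.le]
    push_cast
    rw [add_comm (1 : ℝ)]
    ring
  have hunit : (T / N) ^ (α - 1) * (T / N * (T / N) ^ (-α)) = 1 := by
    rw [← Real.rpow_one_add' ht.le (by linarith), ← Real.rpow_add ht]
    ring_nf
    exact Real.rpow_zero _
  have hgrowth : K * κ * (S (m + 1) + S m) ≤ B⁻¹ * (θ / (1 - θ)) ^ (m + 1) * S 0 := by
    have h1 : S (m + 1) + S m ≤ ((θ / (1 - θ)) ^ (m + 1) + (θ / (1 - θ)) ^ m) * S 0 := by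
      linarith [hgeo (m + 1), hgeo m]
    have h2 : K * κ ≤ B⁻¹ * θ := by
      rw [inv_mul_eq_div, le_div_iff₀ hB]
      linarith
    calc _ ≤ B⁻¹ * θ * (((θ / (1 - θ)) ^ (m + 1) + (θ / (1 - θ)) ^ m) * S 0) :=
          mul_le_mul h2 h1 (add_nonneg (hS0 _) (hS0 _)) (by positivity)
      _ = _ := by
          rw [pow_succ]
          field_simp
          ring
  rw [hγ, hscale, Real.mul_rpow (by positivity) ht.le]
  push_cast
  calc _ ≤ ((n : ℝ) + 1) ^ (α - 1) * (K * κ * (S (m + 1) + S m)) :=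
        (hsweep m n (by omega)).trans_eq (by ring)
    _ ≤ ((n : ℝ) + 1) ^ (α - 1) * (B⁻¹ * (θ / (1 - θ)) ^ (m + 1) * S 0) := by gcongr
    _ = B⁻¹ * ((n : ℝ) + 1) ^ (α - 1) * (θ / (1 - θ)) ^ (m + 1)
        * ((T / N) ^ (α - 1) * (T / N * (T / N) ^ (-α))) * S 0 := by rw [hunit]; ring
    _ = _ := by ring
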